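/- Let $V$ be a complex vector space of finite dimension $r$, let $G\subset \mathrm{GL}(V)$ be a complex reflection group (a finite group generated by elements fixing a hyperplane pointwise), let $N\trianglelefteq G$ be a normal subgroup generated by reflections, and let $H=G/N$. For a finite group $\Gamma$ acting linearly on a vector space $W$ of dimension $r$ such that $S(W^*)^\Gamma$ is generated by $r$ homogeneous algebraically independent polynomials (fundamental invariants), the degrees $d_1^\Gamma,\dots,d_r^\Gamma$ of $\Gamma$ on $W$ are the degrees of these polynomials. For an $m$-dimensional $\Gamma$-module $M$, the numbers $e_1^\Gamma(M),\dots,e_m^\Gamma(M)$ are defined by $$\sum_{n\ge 0} \dim \mathrm{Hom}_\Gamma\bigl(M,(\mathbb{C}[W]_\Gamma)_n\bigr)\,q^n=\sum_{i=1}^m q^{e_i^\Gamma(M)},$$ where $\mathbb{C}[W]_\Gamma$ is the coinvariant ring, i.e. the quotient of $S(W^*)$ by the ideal generated by the homogeneous invariants of positive degree. For $\Gamma=N,G$ take $W=V$. Then there are fundamental invariants $N_1,\dots,N_r\in S(V^*)^N$ of $N$ whose span $E^*=\mathrm{span}_{\mathbb{C}}\{N_1,\dots,N_r\}$ is $G$-stable.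 For every such choice, let $E=V/N$ be the vector space dual to $E^*$, on which $G$ acts, with $N$ acting trivially, so that $H$ acts on $E$; for $\Gamma=H$ take $W=E$, where $S(E^*)$ has its usual grading with $E^*$ in degree $1$. Then the degrees $d_i^N$, $d_i^G$ (on $V$) and $d_i^H$ (on $E$) and the numbers $e_i^N(V)$, $e_i^G(V)$, $e_i^G(E)$, $e_i^H(E)$ exist and can be indexed by $i=1,\dots,r$ in such a way that, for all $i$, one has $e_i^N(V)=d_i^N-1$, $e_i^G(V)=d_i^G-1$, $e_i^H(E)=d_i^H-1$, and \begin{align*} e_i^N(V)+e_i^G(E)&=e_i^G(V),\\ d_i^N\cdot d_i^H&=d_i^G,\\ d_i^N\cdot e_i^H(E)&=e_i^G(E). \end{align*} -/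

import Mathlib

noncomputable section

namespace ReflQuot

open Module

/-- A reflection: an element of `GL(V)` fixing some hyperplane pointwise. -/
def IsReflection {V : Type*} [AddCommGroup V] [Module ℂ V]
    (g : LinearMap.GeneralLinearGroup ℂ V) : Prop :=
  ∃ L : Submodule ℂ V, finrank ℂ L + 1 = finrank ℂ V ∧
    ∀ v ∈ L, (g : V →ₗ[ℂ] V) v = v

/-- A complex reflection group: a finite subgroup of `GL(V)` generated by reflections. -/
structure IsReflectionGroup {V : Type*} [AddCommGroup V] [Module ℂ V]
    (G : Subgroup (LinearMap.GeneralLinearGroup ℂ V)) : Prop where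
  finite : Finite G
  generated : Subgroup.closure {g | g ∈ G ∧ IsReflection g} = G

/-- The action of a subgroup of `GL(V)` on `V`. -/
def stdRep {V : Type*} [AddCommGroup V] [Module ℂ V]
    (G : Subgroup (LinearMap.GeneralLinearGroup ℂ V)) : Representation ℂ G V :=
  (Units.coeHom (V →ₗ[ℂ] V)).comp G.subtype

/-- `S(V^*)`, the algebra of polynomial functions on `V`. -/
abbrev Poly (V : Type*) [AddCommGroup V] [Module ℂ V] : Type _ :=
  SymmetricAlgebra ℂ (Dual ℂ V)

/-- The homogeneous component of degree `n` of `S(V^*)`: the span of the products of `n` linear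
forms. -/
def homog (V : Type*) [AddCommGroup V] [Module ℂ V] (n : ℕ) : Submodule ℂ (Poly V) :=
  (LinearMap.range (SymmetricAlgebra.ι ℂ (Dual ℂ V))) ^ n

section Rep

variable {Γ V : Type*} [Group Γ] [AddCommGroup V] [Module ℂ V] (ρ : Representation ℂ Γ V)

/-- The algebra endomorphism of `S(V^*)` by which `g` acts; it extends the (dual) action on
`V^*`. -/
def polyHom (g : Γ) : Poly V →ₐ[ℂ] Poly V :=
  SymmetricAlgebra.lift ((SymmetricAlgebra.ι ℂ (Dual ℂ V)).comp (ρ.dual g))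

theorem polyHom_ι (g : Γ) (x : Dual ℂ V) :
    polyHom ρ g (SymmetricAlgebra.ι ℂ _ x) = SymmetricAlgebra.ι ℂ _ (ρ.dual g x) := by
  simp [polyHom]

theorem polyHom_one : polyHom ρ 1 = AlgHom.id ℂ (Poly V) := by
  apply SymmetricAlgebra.algHom_ext
  ext x
  change polyHom ρ 1 (SymmetricAlgebra.ι ℂ _ x) = SymmetricAlgebra.ι ℂ _ x
  rw [polyHom_ι, map_one]
  rfl

theorem polyHom_mul (g h : Γ) : polyHom ρ (g * h) = (polyHom ρ g).comp (polyHom ρ h) := by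
  apply SymmetricAlgebra.algHom_ext
  ext x
  change polyHom ρ (g * h) (SymmetricAlgebra.ι ℂ _ x) =
    polyHom ρ g (polyHom ρ h (SymmetricAlgebra.ι ℂ _ x))
  rw [polyHom_ι, polyHom_ι, polyHom_ι, map_mul]
  rfl

/-- The representation on `S(V^*)` induced by a representation on `V`. -/
def polyRep : Representation ℂ Γ (Poly V) where
  toFun g := (polyHom ρ g).toLinearMap
  map_one' := by rw [polyHom_one]; rfl
  map_mul' g h := by rw [polyHom_mul]; rfl

theorem polyRep_apply (g : Γ) (f : Poly V) : polyRep ρ g f = polyHom ρ g f := rfl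

/-- The ring of invariants `S(V^*)^Γ`. -/
def invariantRing : Subalgebra ℂ (Poly V) where
  carrier := {f | ∀ g, polyRep ρ g f = f}
  mul_mem' {a b} ha hb g := by
    rw [polyRep_apply, map_mul]; exact congrArg₂ _ (ha g) (hb g)
  add_mem' {a b} ha hb g := by
    rw [map_add, ha g, hb g]
  algebraMap_mem' c g := by
    rw [polyRep_apply, AlgHom.commutes]

/-- `f 0, …, f (r-1)` is a system of fundamental invariants of degrees `d 0, …, d (r-1)`, where
`r = dim V`: homogeneous algebraically independent generators of the ring of invariants. -/
structure IsFundamentalInvariants {r : ℕ} (f : Fin r → Poly V) (d : Fin r → ℕ) : Prop where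
  dim : finrank ℂ V = r
  homogeneous : ∀ i, f i ∈ homog V (d i)
  algebraicIndependent : AlgebraicIndependent ℂ f
  generate : Algebra.adjoin ℂ (Set.range f) = invariantRing ρ

/-- `d` lists (in some order) the degrees of `Γ` acting on `V`. -/
def HasDegrees {r : ℕ} (d : Fin r → ℕ) : Prop :=
  ∃ f : Fin r → Poly V, IsFundamentalInvariants ρ f d

/-- The ideal of `S(V^*)` generated by the homogeneous invariants of positive degree. -/
def hilbertIdeal : Ideal (Poly V) :=
  Ideal.span {f | f ∈ invariantRing ρ ∧ ∃ n, 0 < n ∧ f ∈ homog V n}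

theorem hilbertIdeal_stable (g : Γ) :
    (hilbertIdeal ρ).restrictScalars ℂ ≤
      ((hilbertIdeal ρ).restrictScalars ℂ).comap (polyRep ρ g) := by
  have h : hilbertIdeal ρ ≤ (hilbertIdeal ρ).comap (polyHom ρ g) := by
    refine Ideal.span_le.2 fun f hf => ?_
    change polyHom ρ g f ∈ hilbertIdeal ρ
    have h1 : polyHom ρ g f = f := hf.1 g
    rw [h1]
    exact Ideal.subset_span hf
  exact fun f hf => h hf

/-- The coinvariant ring `ℂ[V]_Γ`, the quotient of `S(V^*)` by the Hilbert ideal, as a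
representation of `Γ`. -/
def coinvariantRep : Representation ℂ Γ (Poly V ⧸ (hilbertIdeal ρ).restrictScalars ℂ) :=
  (polyRep ρ).quotient _ (hilbertIdeal_stable ρ)

theorem polyHom_homog (g : Γ) (n : ℕ) {f : Poly V} (hf : f ∈ homog V n) :
    polyRep ρ g f ∈ homog V n := by
  have h1 : (LinearMap.range (SymmetricAlgebra.ι ℂ (Dual ℂ V))).map (polyHom ρ g).toLinearMap ≤
      LinearMap.range (SymmetricAlgebra.ι ℂ (Dual ℂ V)) := by
    rintro _ ⟨_, ⟨x, rfl⟩, rfl⟩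
    exact ⟨ρ.dual g x, (polyHom_ι ρ g x).symm⟩
  have h2 : (homog V n).map (polyHom ρ g).toLinearMap ≤ homog V n := by
    rw [homog, Submodule.map_pow]
    exact pow_le_pow_left' h1 n
  exact h2 ⟨f, hf, rfl⟩

/-- The component of degree `n` of the coinvariant ring, as a representation of `Γ`. -/
def coinvariantPiece (n : ℕ) : Subrepresentation (coinvariantRep ρ) where
  toSubmodule := (homog V n).map ((hilbertIdeal ρ).restrictScalars ℂ).mkQ
  apply_mem_toSubmodule g := by
    rintro _ ⟨f, hf, rfl⟩
    exact ⟨polyRep ρ g f, polyHom_homog ρ g n hf, rfl⟩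

/-- The fake degree of a `Γ`-module `M`, as a formal power series: the coefficient of `q^n` is
`dim Hom_Γ(M, (ℂ[V]_Γ)_n)`. -/
def fakeDegree {M : Type*} [AddCommGroup M] [Module ℂ M] (σ : Representation ℂ Γ M) :
    PowerSeries ℕ :=
  PowerSeries.mk fun n =>
    finrank ℂ (Representation.IntertwiningMap σ (coinvariantPiece ρ n).toRepresentation)

/-- `e` lists (in some order) the exponents occurring in the fake degree of the `Γ`-module `M`:
`f_M(q) = ∑ i, q ^ e i`, where `i` runs over `dim M` indices. -/
structure HasFakeDegrees {M : Type*} [AddCommGroup M] [Module ℂ M] (σ : Representation ℂ Γ M)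
    {m : ℕ} (e : Fin m → ℕ) : Prop where
  dim : finrank ℂ M = m
  eq : fakeDegree ρ σ = ∑ i, (PowerSeries.X : PowerSeries ℕ) ^ e i

/-- A model of the quotient `E = V/N`, given by its dual `E^*`: a `Γ`-stable subspace of `S(V^*)`
which is the span of a system of fundamental invariants of `N`. -/
structure QuotientSpace (N : Subgroup Γ) where
  dualSpace : Subrepresentation (polyRep ρ)
  spanned : ∃ (r : ℕ) (f : Fin r → Poly V) (d : Fin r → ℕ),
    IsFundamentalInvariants (ρ.comp N.subtype) f d ∧
      Submodule.span ℂ (Set.range f) = dualSpace.toSubmodule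

namespace QuotientSpace

variable {ρ} {N : Subgroup Γ} (E : QuotientSpace ρ N)

theorem dualSpace_le :
    ∀ f ∈ E.dualSpace.toSubmodule, f ∈ invariantRing (ρ.comp N.subtype) := by
  obtain ⟨r, f, d, hf, hs⟩ := E.spanned
  rw [← hs, ← hf.generate]
  intro x hx
  exact Algebra.span_le_adjoin ℂ _ hx

theorem isTrivial :
    Representation.IsTrivial ((E.dualSpace.toRepresentation).comp N.subtype) where
  out n := by
    ext x
    exact E.dualSpace_le x.1 x.2 n

/-- The vector space `E`, dual to `E^*`. -/
abbrev Space : Type _ := Dual ℂ E.dualSpace.toSubmodule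

/-- The action of `G` on `E`. -/
def rep : Representation ℂ Γ E.Space := E.dualSpace.toRepresentation.dual

/-- The action of `H = G/N` on `E`, dual to `(gN) f = g f` on `E^*`. -/
def quotientRep [N.Normal] : Representation ℂ (Γ ⧸ N) E.Space :=
  haveI := E.isTrivial
  (Representation.ofQuotient E.dualSpace.toRepresentation N).dual

end QuotientSpace

end Rep

end ReflQuot

end

/-!
Let `N_1, …, N_r` be fundamental invariants of `N` spanning the `G`-stable space `E^*`, so that
polynomial functions on `E` are the same as `N`-invariant polynomial functions on `V`. If `F` is a
system of fundamental invariants of `G/N` on `E`, then pulling it back to `V` gives fundamental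
invariants of `G` on `V`. The action of `G/N` respects the decomposition of `E^*` into homogeneous
components (with respect to the degree on `V`), and it is a reflection group on each of them, so
that each `F i` can be chosen to involve only generators of one degree `d i`
(`exists_pure_invariants`). Then `F i` of degree `n i` on `E` has degree `d i * n i` on `V`, and all
three identities reduce to the following description of fake degrees.

Call an invariant decomposable if it lies in the square of the ideal of invariants without constant
term. Fundamental invariants of a reflection group are homogeneous invariants, as many as the
dimension, which are independent modulo the decomposable ones. Let `M` be a module with an
equivariant map `t` from `M^*` to the polynomials without constant term. An invariant `F` in
`t(M^*)` times the polynomials of degree `e` is the contraction with `t` of an equivariant map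
`M → S(V^*)` of degree `e` (a covariant); if several `F` are independent modulo the decomposable
invariants, then the covariants are independent modulo the Hilbert ideal
(`linearIndependent_of_contract`). If there are `dim M` of them, their degrees are the numbers
`e_i(M)` (`hasFakeDegrees_of_indecomposable`). For `M = V` and `t` the inclusion of the linear forms
this gives `e_i(V) = d_i - 1`; for `M = E` and `t` the inclusion of `E^*` into `S(V^*)` it gives
`e_i(E) = d i * (n i - 1)`.

The description rests on Chevalley's lemma (`mem_hilbertIdeal_of_mul_mem`): it implies that
homogeneous covariants independent modulo the Hilbert ideal are linearly independent over the ring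
of invariants (`eq_zero_of_sum_mul_eq_zero`), hence, by Artin's descent, over the ring of
polynomials, so that there are at most `dim M` of them (`card_le_finrank_of_linearIndependent`). For
`M = V` this bounds the number of indecomposable invariants by `dim V`; since polynomials are
integral over the invariants, transcendence degrees give the opposite bound, and the invariants form
a polynomial ring.

A stable space `E^*` exists because the projection of the polynomials onto the span of fundamental
invariants of `N` along the decomposable ones can be averaged over `G` (`nonempty_quotientSpace`).
That reflections of `V` act on `E` as reflections or trivially follows by restricting `E^*` to the
reflecting hyperplane (`finrank_range_sub_one_le`).
-/

noncomputable section

namespace ReflQuot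

open Module

/-! ### The grading of `S(V^*)` -/

section Grading

variable {V : Type*} [AddCommGroup V] [Module ℂ V]

instance homog_gradedMonoid : SetLike.GradedMonoid (homog V) :=
  Submodule.nat_power_gradedMonoid (LinearMap.range (SymmetricAlgebra.ι ℂ (Dual ℂ V)))

theorem ι_mem_homog (x : Dual ℂ V) : SymmetricAlgebra.ι ℂ (Dual ℂ V) x ∈ homog V 1 := by
  simp [homog]

variable (V) in
/-- The inclusion of the linear forms into the degree `1` part of the direct sum of the homogeneous
components. -/
def gradedι : Dual ℂ V →ₗ[ℂ] DirectSum ℕ fun n => homog V n :=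
  DirectSum.lof ℂ ℕ (fun n => homog V n) 1 ∘ₗ
    (SymmetricAlgebra.ι ℂ (Dual ℂ V)).codRestrict _ ι_mem_homog

theorem gradedι_apply (x : Dual ℂ V) :
    gradedι V x = DirectSum.of (fun n => homog V n) 1
      ⟨SymmetricAlgebra.ι ℂ (Dual ℂ V) x, ι_mem_homog x⟩ := rfl

instance homog_gradedAlgebra : GradedAlgebra (homog V) :=
  GradedAlgebra.ofAlgHom _ (SymmetricAlgebra.lift (gradedι V))
    (by
      apply SymmetricAlgebra.algHom_ext
      ext x
      change DirectSum.coeAlgHom (homog V) (SymmetricAlgebra.lift (gradedι V)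
        (SymmetricAlgebra.ι ℂ _ x)) = SymmetricAlgebra.ι ℂ _ x
      rw [SymmetricAlgebra.lift_ι_apply, gradedι_apply, DirectSum.coeAlgHom_of])
    fun i x => by
      obtain ⟨x, hx⟩ := x
      unfold homog at hx
      dsimp only [DirectSum.lof_eq_of]
      induction hx using Submodule.pow_induction_on_left' with
      | algebraMap r =>
        rw [AlgHom.commutes, DirectSum.algebraMap_apply]; rfl
      | add x y i hx hy ihx ihy =>
        rw [map_add, ihx, ihy, ← map_add]
        rfl
      | mem_mul m hm i x hx ih =>
        obtain ⟨_, rfl⟩ := hm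
        rw [map_mul, ih, SymmetricAlgebra.lift_ι_apply, gradedι_apply, DirectSum.of_mul_of]
        exact DirectSum.of_eq_of_gradedMonoid_eq (Sigma.subtype_ext (add_comm _ _) rfl)

variable (V) in
/-- The projection of `S(V^*)` onto its homogeneous component of degree `n`. -/
def part (n : ℕ) : Poly V →ₗ[ℂ] Poly V := GradedAlgebra.proj (homog V) n

theorem part_apply (n : ℕ) (f : Poly V) :
    part V n f = (DirectSum.decompose (homog V) f n : Poly V) := rfl

theorem part_mem (n : ℕ) (f : Poly V) : part V n f ∈ homog V n := by
  rw [part_apply]; exact SetLike.coe_mem _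

theorem part_of_mem {n : ℕ} {f : Poly V} (hf : f ∈ homog V n) : part V n f = f := by
  rw [part_apply]; exact DirectSum.decompose_of_mem_same _ hf

theorem part_of_mem_ne {m n : ℕ} {f : Poly V} (hf : f ∈ homog V m) (h : m ≠ n) :
    part V n f = 0 := by
  rw [part_apply]; exact DirectSum.decompose_of_mem_ne _ hf h

theorem exists_eq_sum_part (f : Poly V) : ∃ s : Finset ℕ, f = ∑ n ∈ s, part V n f := by
  classical
  exact ⟨_, (DirectSum.sum_support_decompose (homog V) f).symm⟩

theorem mem_of_part_mem {S : Submodule ℂ (Poly V)} {f : Poly V} (h : ∀ n, part V n f ∈ S) :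
    f ∈ S := by
  obtain ⟨s, hs⟩ := exists_eq_sum_part f
  rw [hs]
  exact S.sum_mem fun n _ => h n

theorem eq_zero_of_part {f : Poly V} (h : ∀ n, part V n f = 0) : f = 0 := by
  have := mem_of_part_mem (S := ⊥) (f := f) (by simpa using h)
  simpa using this

theorem mul_mem_homog {m n : ℕ} {f g : Poly V} (hf : f ∈ homog V m) (hg : g ∈ homog V n) :
    f * g ∈ homog V (m + n) :=
  SetLike.GradedMul.mul_mem hf hg

theorem part_mul_of_mem {m : ℕ} {f : Poly V} (hf : f ∈ homog V m) (n : ℕ) (g : Poly V) :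
    part V (m + n) (f * g) = f * part V n g := by
  rw [part_apply, part_apply]; exact DirectSum.coe_decompose_mul_add_of_left_mem (homog V) hf

theorem part_mul_of_lt {m n : ℕ} {f : Poly V} (hf : f ∈ homog V m) (h : n < m) (g : Poly V) :
    part V n (f * g) = 0 := by
  rw [part_apply]
  exact DirectSum.coe_decompose_mul_of_left_mem_of_not_le (homog V) hf (not_le.2 h)

theorem part_comm {V' : Type*} [AddCommGroup V'] [Module ℂ V'] (φ : Poly V →ₗ[ℂ] Poly V')
    (hφ : ∀ n, ∀ f ∈ homog V n, φ f ∈ homog V' n) (n : ℕ) (f : Poly V) :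
    part V' n (φ f) = φ (part V n f) := by
  obtain ⟨s, hs⟩ := exists_eq_sum_part f
  have h : ∀ m, part V' n (φ (part V m f)) = φ (part V n (part V m f)) := fun m => by
    by_cases hm : m = n
    · subst hm
      rw [part_of_mem (hφ _ _ (part_mem _ _)), part_of_mem (part_mem _ _)]
    · rw [part_of_mem_ne (hφ _ _ (part_mem _ _)) hm, part_of_mem_ne (part_mem _ _) hm, map_zero]
  rw [hs]
  simp only [map_sum, h]

theorem homog_zero : homog V 0 = 1 := pow_zero _

theorem exists_eq_algebraMap_of_mem_homog_zero {f : Poly V} (hf : f ∈ homog V 0) :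
    ∃ c : ℂ, f = algebraMap ℂ (Poly V) c := by
  rw [homog_zero, Submodule.mem_one] at hf
  obtain ⟨c, hc⟩ := hf
  exact ⟨c, hc.symm⟩

theorem algebraMap_mem_homog_zero (c : ℂ) : algebraMap ℂ (Poly V) c ∈ homog V 0 := by
  rw [homog_zero, Submodule.mem_one]; exact ⟨c, rfl⟩

theorem part_zero_algebraMap (c : ℂ) :
    part V 0 (algebraMap ℂ (Poly V) c) = algebraMap ℂ (Poly V) c :=
  part_of_mem (algebraMap_mem_homog_zero c)

theorem homog_succ (n : ℕ) : homog V (n + 1) =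
    LinearMap.range (SymmetricAlgebra.ι ℂ (Dual ℂ V)) * homog V n := pow_succ' _ _

theorem part_zero_mul (f g : Poly V) : part V 0 (f * g) = part V 0 f * part V 0 g :=
  map_mul (GradedRing.projZeroRingHom (homog V)) f g

/-- A cofactor of a nonzero homogeneous element in a homogeneous product is homogeneous. -/
theorem mem_homog_of_mul_mem {m n : ℕ} {f g : Poly V} (hf : f ∈ homog V m) (h0 : f ≠ 0)
    (h : f * g ∈ homog V (m + n)) : g ∈ homog V n := by
  refine mem_of_part_mem fun k => ?_
  by_cases hk : k = n
  · subst hk; exact part_mem _ _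
  · have h1 : f * part V k g = 0 := by
      rw [← part_mul_of_mem hf, part_of_mem_ne h (by omega)]
    rw [(mul_eq_zero.1 h1).resolve_left h0]
    exact zero_mem _

end Grading

/-! ### Averaging -/

section Averaging

variable {Γ X : Type*} [Group Γ] [Fintype Γ] [AddCommGroup X] [Module ℂ X]
  (τ : Representation ℂ Γ X)

/-- The averaging operator (Reynolds operator) of a representation of a finite group. -/
def avg : X →ₗ[ℂ] X := (Fintype.card Γ : ℂ)⁻¹ • ∑ g, τ g

theorem avg_apply (x : X) : avg τ x = (Fintype.card Γ : ℂ)⁻¹ • ∑ g, τ g x := by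
  simp [avg]

theorem apply_avg (h : Γ) (x : X) : τ h (avg τ x) = avg τ x := by
  rw [avg_apply, map_smul, map_sum]
  congr 1
  exact Fintype.sum_equiv (Equiv.mulLeft h) _ _ fun g => by simp

theorem avg_of_invariant {x : X} (hx : ∀ g, τ g x = x) : avg τ x = x := by
  rw [avg_apply]
  simp only [hx, Finset.sum_const, Finset.card_univ]
  rw [← Nat.cast_smul_eq_nsmul ℂ, smul_smul, inv_mul_cancel₀, one_smul]
  exact_mod_cast Fintype.card_ne_zero

theorem avg_mem {S : Submodule ℂ X} {x : X} (h : ∀ g, τ g x ∈ S) : avg τ x ∈ S := by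
  rw [avg_apply]
  exact S.smul_mem _ (S.sum_mem fun g _ => h g)

theorem avg_sub_self_mem {S : Submodule ℂ X} {x : X} (h : ∀ g, τ g x - x ∈ S) :
    avg τ x - x ∈ S := by
  have h1 : avg τ x - x = (Fintype.card Γ : ℂ)⁻¹ • ∑ g, (τ g x - x) := by
    have h0 : (Fintype.card Γ : ℂ) ≠ 0 := by exact_mod_cast Fintype.card_ne_zero
    rw [Finset.sum_sub_distrib, smul_sub, ← avg_apply, Finset.sum_const, Finset.card_univ,
      ← Nat.cast_smul_eq_nsmul ℂ, smul_smul, inv_mul_cancel₀ h0, one_smul]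
  rw [h1]
  exact S.smul_mem _ (S.sum_mem fun g _ => h g)

end Averaging

/-! ### Invariants of positive degree and the Hilbert ideal -/

section Invariants

variable {Γ V : Type*} [Group Γ] [AddCommGroup V] [Module ℂ V] (ρ : Representation ℂ Γ V)

theorem polyRep_mul (g : Γ) (a b : Poly V) :
    polyRep ρ g (a * b) = polyRep ρ g a * polyRep ρ g b :=
  map_mul (polyHom ρ g) a b

theorem polyRep_ι (g : Γ) (x : Dual ℂ V) :
    polyRep ρ g (SymmetricAlgebra.ι ℂ _ x) = SymmetricAlgebra.ι ℂ _ (ρ.dual g x) :=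
  polyHom_ι ρ g x

theorem part_polyRep (g : Γ) (n : ℕ) (f : Poly V) :
    part V n (polyRep ρ g f) = polyRep ρ g (part V n f) :=
  part_comm _ (fun n _ hf => polyHom_homog ρ g n hf) n f

theorem part_mem_invariantRing {f : Poly V} (hf : f ∈ invariantRing ρ) (n : ℕ) :
    part V n f ∈ invariantRing ρ := fun g => by
  rw [← part_polyRep, hf g]

/-- The invariants without constant term. -/
def posInv : Submodule ℂ (Poly V) :=
  Subalgebra.toSubmodule (invariantRing ρ) ⊓ LinearMap.ker (part V 0)

/-- The decomposable invariants: the square of the ideal of invariants without constant term. -/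
def decomposables : Submodule ℂ (Poly V) := posInv ρ * posInv ρ

theorem mem_posInv {f : Poly V} : f ∈ posInv ρ ↔ f ∈ invariantRing ρ ∧ part V 0 f = 0 := Iff.rfl

theorem mem_posInv_of_mem_homog {f : Poly V} (hf : f ∈ invariantRing ρ) {n : ℕ}
    (hn : f ∈ homog V n) (h0 : 0 < n) : f ∈ posInv ρ :=
  ⟨hf, part_of_mem_ne hn h0.ne'⟩

theorem part_mem_posInv {f : Poly V} (hf : f ∈ posInv ρ) (n : ℕ) : part V n f ∈ posInv ρ := by
  rcases Nat.eq_zero_or_pos n with rfl | hn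
  · rw [((mem_posInv ρ).1 hf).2]; exact zero_mem _
  · exact mem_posInv_of_mem_homog ρ (part_mem_invariantRing ρ hf.1 n) (part_mem n f) hn

theorem decomposables_le_posInv : decomposables ρ ≤ posInv ρ := by
  refine Submodule.mul_le.2 fun a ha b hb => ⟨(invariantRing ρ).mul_mem ha.1 hb.1, ?_⟩
  change part V 0 (a * b) = 0
  rw [part_zero_mul, ((mem_posInv ρ).1 ha).2, zero_mul]

/-- The components of an element of a product of graded subspaces lie in the product. -/
theorem part_mem_mul {A B : Submodule ℂ (Poly V)} (hA : ∀ n, ∀ a ∈ A, part V n a ∈ A)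
    (hB : ∀ n, ∀ b ∈ B, part V n b ∈ B) {f : Poly V} (hf : f ∈ A * B) (n : ℕ) :
    part V n f ∈ A * B := by
  induction hf using Submodule.mul_induction_on' with
  | mem_mul_mem a ha b hb =>
    obtain ⟨s, hs⟩ := exists_eq_sum_part a
    rw [hs, Finset.sum_mul, map_sum]
    refine Submodule.sum_mem _ fun k _ => ?_
    rcases lt_or_ge n k with h | h
    · rw [part_mul_of_lt (part_mem k a) h]; exact zero_mem _
    · obtain ⟨m, rfl⟩ := Nat.exists_eq_add_of_le h
      rw [part_mul_of_mem (part_mem k a)]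
      exact Submodule.mul_mem_mul (hA _ _ ha) (hB _ _ hb)
  | add x _ y _ hx hy => rw [map_add]; exact add_mem hx hy

theorem part_mem_decomposables {f : Poly V} (hf : f ∈ decomposables ρ) (n : ℕ) :
    part V n f ∈ decomposables ρ :=
  part_mem_mul (fun n _ ha => part_mem_posInv ρ ha n) (fun n _ ha => part_mem_posInv ρ ha n) hf n

theorem posInv_le_hilbertIdeal : posInv ρ ≤ (hilbertIdeal ρ).restrictScalars ℂ := fun f hf => by
  refine mem_of_part_mem fun n => ?_
  rcases Nat.eq_zero_or_pos n with rfl | hn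
  · rw [((mem_posInv ρ).1 hf).2]; exact zero_mem _
  · exact Ideal.subset_span ⟨part_mem_invariantRing ρ hf.1 n, n, hn, part_mem n f⟩

theorem hilbertIdeal_eq : (hilbertIdeal ρ).restrictScalars ℂ = posInv ρ * ⊤ := by
  apply le_antisymm
  · intro f hf
    refine Submodule.span_induction (p := fun x _ => x ∈ posInv ρ * ⊤) ?_ (zero_mem _)
      (fun _ _ _ _ h1 h2 => add_mem h1 h2) (fun a x _ h => ?_) hf
    · rintro x ⟨hx, n, hn, hxn⟩
      rw [← mul_one x]
      exact Submodule.mul_mem_mul (mem_posInv_of_mem_homog ρ hx hxn hn) trivial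
    · refine Submodule.mul_induction_on h (fun m hm n _ => ?_) fun y z hy hz => ?_
      · rw [smul_eq_mul, mul_left_comm]
        exact Submodule.mul_mem_mul hm Submodule.mem_top
      · rw [smul_add]
        exact add_mem hy hz
  · refine Submodule.mul_le.2 fun a ha b _ => ?_
    exact Ideal.mul_mem_right _ _ (posInv_le_hilbertIdeal ρ ha)

theorem part_mem_hilbertIdeal {f : Poly V} (hf : f ∈ hilbertIdeal ρ) (n : ℕ) :
    part V n f ∈ hilbertIdeal ρ := by
  have h : f ∈ posInv ρ * ⊤ := by rw [← hilbertIdeal_eq]; exact hf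
  have h2 := part_mem_mul (fun n _ ha => part_mem_posInv ρ ha n)
    (fun _ _ _ => Submodule.mem_top) h n
  rw [← hilbertIdeal_eq] at h2
  exact h2

variable [Fintype Γ]

theorem avg_mem_invariantRing (f : Poly V) : avg (polyRep ρ) f ∈ invariantRing ρ :=
  fun g => apply_avg _ g f

theorem avg_mem_homog {f : Poly V} {n : ℕ} (hf : f ∈ homog V n) :
    avg (polyRep ρ) f ∈ homog V n :=
  avg_mem _ fun g => polyHom_homog ρ g n hf

theorem avg_mul_of_invariant {a : Poly V} (ha : a ∈ invariantRing ρ) (b : Poly V) :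
    avg (polyRep ρ) (a * b) = a * avg (polyRep ρ) b := by
  have ha' : ∀ g, polyRep ρ g a = a := ha
  simp only [avg_apply, polyRep_mul, ha', mul_smul_comm, Finset.mul_sum]

/-- An invariant in the product of the Hilbert ideal and the ideal of polynomials without constant
term is decomposable: average the cofactors. -/
theorem mem_decomposables_of_invariant {f : Poly V} (hf : f ∈ invariantRing ρ)
    (h : f ∈ posInv ρ * LinearMap.ker (part V 0)) : f ∈ decomposables ρ := by
  have key : ∀ x ∈ posInv ρ * LinearMap.ker (part V 0),
      avg (polyRep ρ) x ∈ decomposables ρ := by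
    intro x hx
    induction hx using Submodule.mul_induction_on' with
    | mem_mul_mem a ha b hb =>
      rw [avg_mul_of_invariant ρ ha.1]
      refine Submodule.mul_mem_mul ha ⟨avg_mem_invariantRing ρ b, ?_⟩
      refine avg_mem _ fun g => ?_
      rw [LinearMap.mem_ker, part_polyRep, LinearMap.mem_ker.1 hb, map_zero]
    | add x _ y _ hx hy => rw [map_add]; exact add_mem hx hy
  rw [← avg_of_invariant (polyRep ρ) hf]
  exact key f h

end Invariants

/-! ### Chevalley's lemma -/

section Chevalley

variable {Γ V : Type*} [Group Γ] [AddCommGroup V] [Module ℂ V] (ρ : Representation ℂ Γ V)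

/-- The group is generated by elements acting on `V^*` (equivalently, for `V` of finite dimension,
on `V`) as a reflection or trivially. The representation need not be faithful. -/
def GeneratedByReflections : Prop :=
  Subgroup.closure {g | finrank ℂ (LinearMap.range (ρ.dual g - 1)) ≤ 1} = ⊤

/-- A reflection `g` changes a polynomial only by a multiple of the linear form defining its
hyperplane. -/
theorem exists_polyRep_sub_eq_mul [FiniteDimensional ℂ V] {g : Γ}
    (hg : finrank ℂ (LinearMap.range (ρ.dual g - 1)) ≤ 1) :
    ∃ l : Dual ℂ V, ∀ f : Poly V, ∃ q, polyRep ρ g f - f = SymmetricAlgebra.ι ℂ _ l * q := by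
  obtain ⟨⟨l, _⟩, hl⟩ := finrank_le_one_iff.1 hg
  refine ⟨l, fun f => ?_⟩
  induction f using SymmetricAlgebra.induction with
  | algebraMap r => exact ⟨0, by rw [polyRep_apply, AlgHom.commutes]; simp⟩
  | ι x =>
    obtain ⟨c, hc⟩ := hl ⟨_, x, rfl⟩
    have hc' : c • l = ρ.dual g x - x := congrArg Subtype.val hc
    refine ⟨algebraMap ℂ _ c, ?_⟩
    rw [polyRep_ι, ← map_sub, ← hc', map_smul, Algebra.smul_def, mul_comm]
  | mul a b ha hb =>
    obtain ⟨q, hq⟩ := ha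
    obtain ⟨q', hq'⟩ := hb
    refine ⟨q * polyRep ρ g b + a * q', ?_⟩
    rw [polyRep_mul]
    linear_combination polyRep ρ g b * hq + a * hq'
  | add a b ha hb =>
    obtain ⟨q, hq⟩ := ha
    obtain ⟨q', hq'⟩ := hb
    refine ⟨q + q', ?_⟩
    rw [map_add]
    linear_combination hq + hq'

variable {ρ}

/-- Chevalley's lemma: if `u₀` is an invariant outside the ideal generated by other invariants, then
the homogeneous cofactors that carry it into that ideal lie in the Hilbert ideal. -/
theorem mem_hilbertIdeal_of_mul_mem [Fintype Γ] [FiniteDimensional ℂ V]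
    (hρ : GeneratedByReflections ρ) {κ : Type*} {s : Finset κ} {u : κ → Poly V}
    (hu : ∀ a ∈ s, u a ∈ invariantRing ρ) {u₀ : Poly V} (h₀ : u₀ ∈ invariantRing ρ)
    (hn : u₀ ∉ Ideal.span (u '' s)) (n : ℕ) :
    ∀ p ∈ homog V n, u₀ * p ∈ Ideal.span (u '' s) → p ∈ hilbertIdeal ρ := by
  induction n with
  | zero =>
    intro p hp h
    obtain ⟨c, rfl⟩ := exists_eq_algebraMap_of_mem_homog_zero hp
    rcases eq_or_ne c 0 with rfl | hc
    · simp
    · refine absurd ?_ hn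
      have h2 := Ideal.mul_mem_right (algebraMap ℂ (Poly V) c⁻¹) _ h
      rwa [mul_assoc, ← map_mul, mul_inv_cancel₀ hc, map_one, mul_one] at h2
  | succ n ih =>
    intro p hp h
    obtain ⟨c, hc⟩ := (Submodule.mem_span_image_finset_iff_exists_fun' _).1 h
    simp only [smul_eq_mul] at hc
    have key : ∀ g : Γ, polyRep ρ g p - p ∈ hilbertIdeal ρ := by
      intro g
      have hg : g ∈ Subgroup.closure {g | finrank ℂ (LinearMap.range (ρ.dual g - 1)) ≤ 1} := by
        rw [hρ]; trivial
      induction hg using Subgroup.closure_induction with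
      | mem g hg =>
        obtain ⟨l, hl⟩ := exists_polyRep_sub_eq_mul ρ hg
        choose q hq using hl
        by_cases hl0 : SymmetricAlgebra.ι ℂ (Dual ℂ V) l = 0
        · rw [hq, hl0, zero_mul]; exact zero_mem _
        · have h1 : u₀ * q p ∈ Ideal.span (u '' s) := by
            refine (Submodule.mem_span_image_finset_iff_exists_fun' _).2 ⟨fun a => q (c a), ?_⟩
            apply mul_left_cancel₀ hl0
            calc _ = ∑ a ∈ s, (polyRep ρ g (c a) - c a) * u a := by
                  rw [Finset.mul_sum]
                  refine Finset.sum_congr rfl fun a _ => ?_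
                  rw [hq, smul_eq_mul, mul_assoc]
              _ = polyRep ρ g (∑ a ∈ s, c a * u a) - ∑ a ∈ s, c a * u a := by
                  rw [map_sum, ← Finset.sum_sub_distrib]
                  refine Finset.sum_congr rfl fun a ha => ?_
                  rw [polyRep_mul, hu a ha g, sub_mul]
              _ = _ := by
                  rw [hc, polyRep_mul, h₀ g, ← mul_sub, hq]
                  ring
          rw [hq]
          refine Ideal.mul_mem_left _ _ (ih _ (mem_homog_of_mul_mem (ι_mem_homog l) hl0 ?_) h1)
          rw [← hq, add_comm]
          exact sub_mem (polyHom_homog ρ g _ hp) hp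
      | one => simp
      | mul g h _ _ hg hh =>
        have h1 : polyRep ρ g (polyRep ρ h p - p) ∈ hilbertIdeal ρ := hilbertIdeal_stable ρ g hh
        rw [map_mul, Module.End.mul_apply]
        rw [map_sub] at h1
        simpa using add_mem h1 hg
      | inv g _ hg =>
        have h1 : polyRep ρ g⁻¹ (polyRep ρ g p - p) ∈ hilbertIdeal ρ :=
          hilbertIdeal_stable ρ g⁻¹ hg
        rw [map_sub, ← Module.End.mul_apply, ← map_mul, inv_mul_cancel, map_one,
          Module.End.one_apply] at h1
        rw [← neg_sub]
        exact neg_mem h1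
    have h1 : avg (polyRep ρ) p - p ∈ (hilbertIdeal ρ).restrictScalars ℂ :=
      avg_sub_self_mem _ key
    have h2 : avg (polyRep ρ) p ∈ hilbertIdeal ρ :=
      Ideal.subset_span ⟨avg_mem_invariantRing ρ p, _, n.succ_pos, avg_mem_homog ρ hp⟩
    have h3 : avg (polyRep ρ) p - (avg (polyRep ρ) p - p) ∈ hilbertIdeal ρ := sub_mem h2 h1
    rwa [sub_sub_cancel] at h3

end Chevalley

/-! ### Covariants: linear independence modulo the Hilbert ideal -/

section Covariants

variable {Γ V M : Type*} [Group Γ] [AddCommGroup V] [Module ℂ V] [AddCommGroup M] [Module ℂ M]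
  {ρ : Representation ℂ Γ V}

/-- Homogeneous linear maps into `S(V^*)` which are linearly independent modulo the Hilbert ideal
satisfy no homogeneous linear relation with invariant coefficients. In a relation
`∑ u a • ω a = 0`, Chevalley's lemma shows that one coefficient is a combination of the others; this
eliminates one of the maps and modifies the others by a multiple of it. -/
theorem eq_zero_of_sum_mul_eq_zero [Fintype Γ] [FiniteDimensional ℂ V]
    (hρ : GeneratedByReflections ρ) {κ : Type*} (s : Finset κ) (u : κ → Poly V) (b e : κ → ℕ)
    (D : ℕ) (hu : ∀ a ∈ s, u a ∈ invariantRing ρ) (hub : ∀ a ∈ s, u a ∈ homog V (b a))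
    (hD : ∀ a ∈ s, b a + e a = D) :
    ∀ ω : κ → M →ₗ[ℂ] Poly V, (∀ a ∈ s, ∀ v, ω a v ∈ homog V (e a)) →
      (∀ c : κ → ℂ, (∀ v, ∑ a ∈ s, c a • ω a v ∈ hilbertIdeal ρ) → ∀ a ∈ s, c a = 0) →
      (∀ v, ∑ a ∈ s, u a * ω a v = 0) → ∀ a ∈ s, u a = 0 := by
  classical
  induction s using Finset.induction_on with
  | empty => intro _ _ _ _ a ha; simp at ha
  | insert a₀ s ha₀ ih =>
    intro ω hω hind hsum
    simp only [Finset.forall_mem_insert] at hu hub hω hD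
    simp only [Finset.sum_insert ha₀] at hsum
    have hne : ∀ a ∈ s, a ≠ a₀ := fun a ha h => ha₀ (h ▸ ha)
    by_cases h : u a₀ ∈ Ideal.span (u '' s)
    · obtain ⟨c₀, hc₀⟩ := (Submodule.mem_span_image_finset_iff_exists_fun' _).1 h
      simp only [smul_eq_mul] at hc₀
      -- The coefficients can be made invariant and homogeneous.
      obtain ⟨c, hc, hcinv, hcb⟩ : ∃ c : κ → Poly V, ∑ a ∈ s, c a * u a = u a₀ ∧
          (∀ a, c a ∈ invariantRing ρ) ∧
          (∀ a ∈ s, ∀ v, c a * ω a₀ v ∈ homog V (e a)) := by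
        refine ⟨fun a => if b a ≤ b a₀ then avg (polyRep ρ) (part V (b a₀ - b a) (c₀ a)) else 0,
          ?_, ?_, ?_⟩
        · rw [← avg_of_invariant (polyRep ρ) hu.1, ← part_of_mem hub.1, ← hc₀, map_sum, map_sum]
          refine Finset.sum_congr rfl fun a ha => ?_
          rw [mul_comm (c₀ a)]
          dsimp only
          split_ifs with hab
          · obtain ⟨m, hm⟩ := Nat.exists_eq_add_of_le hab
            rw [hm, part_mul_of_mem (hub.2 a ha), avg_mul_of_invariant ρ (hu.2 a ha),
              Nat.add_sub_cancel_left, mul_comm]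
          · rw [part_mul_of_lt (hub.2 a ha) (not_le.1 hab), map_zero, zero_mul]
        · intro a
          dsimp only
          split_ifs
          · exact avg_mem_invariantRing ρ _
          · exact zero_mem _
        · intro a ha v
          dsimp only
          split_ifs with hab
          · have h1 := mul_mem_homog (avg_mem_homog ρ (part_mem (b a₀ - b a) (c₀ a))) (hω.1 v)
            have h2 : b a₀ - b a + e a₀ = e a := by
              have := hD.1
              have := hD.2 a ha
              omega
            rwa [h2] at h1
          · rw [zero_mul]; exact zero_mem _
      have hconst : ∀ a, ∃ k : ℂ, c a - algebraMap ℂ (Poly V) k ∈ hilbertIdeal ρ := by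
        intro a
        obtain ⟨k, hk⟩ := exists_eq_algebraMap_of_mem_homog_zero (part_mem 0 (c a))
        refine ⟨k, posInv_le_hilbertIdeal ρ ⟨?_, ?_⟩⟩
        · exact sub_mem (hcinv a) ((invariantRing ρ).algebraMap_mem k)
        · change part V 0 _ = 0
          rw [map_sub, part_zero_algebraMap, hk, sub_self]
      choose k hk using hconst
      have hs : ∀ a ∈ s, u a = 0 := by
        refine ih hu.2 hub.2 hD.2 (fun a => ω a + LinearMap.mulLeft ℂ (c a) ∘ₗ ω a₀)
          (fun a ha v => add_mem (hω.2 a ha v) (hcb a ha v)) ?_ ?_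
        · intro γ hγ
          have h1 := hind (fun a => if a = a₀ then ∑ a ∈ s, γ a * k a else γ a) fun v => by
            have h2 : ∑ a ∈ s, (γ a • (c a - algebraMap ℂ (Poly V) (k a))) * ω a₀ v ∈
                hilbertIdeal ρ := by
              refine Ideal.sum_mem _ fun a _ => Ideal.mul_mem_right _ _ ?_
              exact Submodule.smul_of_tower_mem _ _ (hk a)
            have h3 := sub_mem (hγ v) h2
            convert h3 using 1
            rw [Finset.sum_insert ha₀, if_pos rfl, Finset.sum_smul, ← Finset.sum_sub_distrib,
              ← Finset.sum_add_distrib]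
            refine Finset.sum_congr rfl fun a ha => ?_
            rw [if_neg (hne a ha)]
            simp only [LinearMap.add_apply, LinearMap.comp_apply, LinearMap.mulLeft_apply,
              Algebra.smul_def, map_mul]
            ring
          intro a ha
          have h4 := h1 a (Finset.mem_insert_of_mem ha)
          rwa [if_neg (hne a ha)] at h4
        · intro v
          rw [← hsum v, ← hc, Finset.sum_mul, ← Finset.sum_add_distrib]
          refine Finset.sum_congr rfl fun a _ => ?_
          simp only [LinearMap.add_apply, LinearMap.comp_apply, LinearMap.mulLeft_apply]
          ring
      refine (Finset.forall_mem_insert _ _ _).2 ⟨?_, hs⟩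
      rw [← hc]
      exact Finset.sum_eq_zero fun a ha => by rw [hs a ha, mul_zero]
    · exfalso
      have h1 : ∀ v, ω a₀ v ∈ hilbertIdeal ρ := fun v => by
        refine mem_hilbertIdeal_of_mul_mem hρ hu.2 hu.1 h _ _ (hω.1 v) ?_
        rw [eq_neg_of_add_eq_zero_left (hsum v)]
        refine neg_mem (Ideal.sum_mem _ fun a ha => Ideal.mul_mem_right _ _ ?_)
        exact Ideal.subset_span ⟨a, ha, rfl⟩
      have h2 := hind (Pi.single a₀ 1) (fun v => by
        rw [Finset.sum_insert ha₀, Pi.single_eq_same, one_smul, Finset.sum_eq_zero, add_zero]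
        · exact h1 v
        · intro a ha
          rw [Pi.single_eq_of_ne (hne a ha), zero_smul]) a₀ (Finset.mem_insert_self _ _)
      rw [Pi.single_eq_same] at h2
      exact one_ne_zero h2

/-- The composite of a linear map into `S(V^*)` with the projection to the coinvariant ring. -/
def toCoinvariants (ρ : Representation ℂ Γ V) :
    (M →ₗ[ℂ] Poly V) →ₗ[ℂ] M →ₗ[ℂ] (Poly V ⧸ (hilbertIdeal ρ).restrictScalars ℂ) :=
  LinearMap.llcomp ℂ _ _ _ ((hilbertIdeal ρ).restrictScalars ℂ).mkQ

theorem toCoinvariants_eq_zero_iff {ω : M →ₗ[ℂ] Poly V} :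
    toCoinvariants ρ ω = 0 ↔ ∀ v, ω v ∈ hilbertIdeal ρ := by
  rw [LinearMap.ext_iff]
  refine forall_congr' fun v => ?_
  change ((hilbertIdeal ρ).restrictScalars ℂ).mkQ (ω v) = 0 ↔ _
  rw [Submodule.mkQ_apply, Submodule.Quotient.mk_eq_zero, Submodule.restrictScalars_mem]

theorem linearIndependent_toCoinvariants_iff {κ : Type*} [Fintype κ] {ω : κ → M →ₗ[ℂ] Poly V} :
    LinearIndependent ℂ (fun a => toCoinvariants ρ (ω a)) ↔
      ∀ c : κ → ℂ, (∀ v, ∑ a, c a • ω a v ∈ hilbertIdeal ρ) → ∀ a, c a = 0 := by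
  rw [Fintype.linearIndependent_iff]
  refine forall_congr' fun c => ?_
  have : ∑ a, c a • toCoinvariants ρ (ω a) = toCoinvariants ρ (∑ a, c a • ω a) := by
    simp
  rw [this, toCoinvariants_eq_zero_iff]
  simp [LinearMap.sum_apply]

theorem eq_zero_of_sum_invariant_mul_eq_zero [Fintype Γ] [FiniteDimensional ℂ V]
    (hρ : GeneratedByReflections ρ) {κ : Type*} [Fintype κ] {ω : κ → M →ₗ[ℂ] Poly V} {e : κ → ℕ}
    (hω : ∀ a v, ω a v ∈ homog V (e a))
    (hind : LinearIndependent ℂ (fun a => toCoinvariants ρ (ω a)))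
    {u : κ → Poly V} (hu : ∀ a, u a ∈ invariantRing ρ) (hsum : ∀ v, ∑ a, u a * ω a v = 0) (a : κ) :
    u a = 0 := by
  classical
  rw [linearIndependent_toCoinvariants_iff] at hind
  refine eq_zero_of_part fun n => ?_
  -- The component of the relation in which `u a` contributes through its component of degree `n`.
  set D := n + e a with hD
  have h1 := eq_zero_of_sum_mul_eq_zero hρ (Finset.univ.filter fun a => e a ≤ D)
    (fun a => part V (D - e a) (u a)) (fun a => D - e a) e D
    (fun a _ => part_mem_invariantRing ρ (hu a) _) (fun a _ => part_mem _ _)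
    (fun a ha => Nat.sub_add_cancel (Finset.mem_filter.1 ha).2) ω (fun a _ => hω a) ?_ ?_ a ?_
  · simpa [hD] using h1
  · intro c hc a ha
    have h2 := hind (fun a => if e a ≤ D then c a else 0) (fun v => by
      have h3 := hc v
      rw [Finset.sum_filter] at h3
      simpa [ite_smul] using h3) a
    rwa [if_pos (Finset.mem_filter.1 ha).2] at h2
  · intro v
    have h3 := congrArg (part V D) (hsum v)
    rw [map_sum, map_zero] at h3
    rw [Finset.sum_filter]
    refine (Finset.sum_congr rfl fun a _ => ?_).trans h3
    rw [mul_comm, mul_comm (u a)]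
    split_ifs with h
    · obtain ⟨m, hm⟩ := Nat.exists_eq_add_of_le h
      rw [hm, part_mul_of_mem (hω a v), Nat.add_sub_cancel_left]
    · rw [part_mul_of_lt (hω a v) (not_le.1 h)]
  · simp [hD]

/-- Artin's descent: equivariant linear maps satisfying no linear relation with invariant
coefficients satisfy no linear relation at all. Multiply a relation by the conjugates of a nonzero
coefficient, so that this coefficient becomes invariant, and average. -/
theorem eq_zero_of_sum_mul_eq_zero_of_invariant [Fintype Γ] {σ : Representation ℂ Γ M}
    [FiniteDimensional ℂ V] {κ : Type*} [Fintype κ] {ω : κ → M →ₗ[ℂ] Poly V}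
    (hσ : ∀ a g v, ω a (σ g v) = polyRep ρ g (ω a v))
    (hinv : ∀ u : κ → Poly V, (∀ a, u a ∈ invariantRing ρ) → (∀ v, ∑ a, u a * ω a v = 0) →
      ∀ a, u a = 0)
    {u : κ → Poly V} (hsum : ∀ v, ∑ a, u a * ω a v = 0) (a : κ) : u a = 0 := by
  classical
  by_contra ha
  set p := ∏ g ∈ Finset.univ.erase (1 : Γ), polyRep ρ g (u a) with hp
  have hprod : p * u a = ∏ g, polyRep ρ g (u a) := by
    rw [← Finset.prod_erase_mul _ _ (Finset.mem_univ (1 : Γ)), map_one, Module.End.one_apply]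
  have hpinv : p * u a ∈ invariantRing ρ := fun h => by
    rw [hprod, polyRep_apply, map_prod]
    refine Fintype.prod_equiv (Equiv.mulLeft h) _ _ fun g => ?_
    rw [Equiv.coe_mulLeft, map_mul, Module.End.mul_apply, polyRep_apply ρ h]
  have h1 := hinv (fun b => avg (polyRep ρ) (p * u b)) (fun b => avg_mem_invariantRing ρ _)
    (fun v => by
      have h2 : ∀ g : Γ, ∑ b, polyRep ρ g (p * u b) * ω b v = 0 := fun g => by
        have h3 := congrArg (fun x => polyRep ρ g (p * x)) (hsum (σ g⁻¹ v))
        simp only [mul_zero, map_zero, Finset.mul_sum, map_sum] at h3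
        rw [← h3]
        refine Finset.sum_congr rfl fun b _ => ?_
        rw [← mul_assoc, polyRep_mul ρ g (p * u b), ← hσ, ← Module.End.mul_apply, ← map_mul,
          mul_inv_cancel, map_one, Module.End.one_apply]
      simp only [avg_apply, smul_mul_assoc, Finset.sum_mul]
      rw [← Finset.smul_sum, Finset.sum_comm]
      simp [h2]) a
  rw [avg_of_invariant _ hpinv, hprod, Finset.prod_eq_zero_iff] at h1
  obtain ⟨g, -, hg⟩ := h1
  apply ha
  have h4 := congrArg (polyRep ρ g⁻¹) hg
  rwa [map_zero, ← Module.End.mul_apply, ← map_mul, inv_mul_cancel, map_one,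
    Module.End.one_apply] at h4

/-- There are at most `dim M` homogeneous covariants of type `M` which are linearly independent
modulo the Hilbert ideal. -/
theorem card_le_finrank_of_linearIndependent [Fintype Γ] [FiniteDimensional ℂ V]
    [FiniteDimensional ℂ M] (hρ : GeneratedByReflections ρ) {σ : Representation ℂ Γ M}
    {κ : Type*} [Fintype κ] {ω : κ → M →ₗ[ℂ] Poly V} {e : κ → ℕ}
    (hω : ∀ a v, ω a v ∈ homog V (e a)) (hσ : ∀ a g v, ω a (σ g v) = polyRep ρ g (ω a v))
    (hind : LinearIndependent ℂ (fun a => toCoinvariants ρ (ω a))) :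
    Fintype.card κ ≤ finrank ℂ M := by
  let b := finBasis ℂ M
  have h : LinearIndependent (Poly V) fun a => fun j => ω a (b j) := by
    rw [Fintype.linearIndependent_iff]
    intro u hu
    refine eq_zero_of_sum_mul_eq_zero_of_invariant hσ (fun u hu hsum =>
      eq_zero_of_sum_invariant_mul_eq_zero hρ hω hind hu hsum) fun v => ?_
    have h1 : (∑ a, LinearMap.mulLeft ℂ (u a) ∘ₗ ω a) = 0 := b.ext fun j => by
      have := congrFun hu j
      simpa [LinearMap.sum_apply, Finset.sum_apply] using this
    simpa [LinearMap.sum_apply] using LinearMap.congr_fun h1 v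
  have h2 := h.fintype_card_le_finrank
  simpa using h2

end Covariants

/-! ### Fake degrees from covariants -/

section FakeDegrees

variable {Γ V M : Type*} [Group Γ] [AddCommGroup V] [Module ℂ V] [AddCommGroup M] [Module ℂ M]
  {ρ : Representation ℂ Γ V} {σ : Representation ℂ Γ M}

/-- The linear maps into `S(V^*)` with values in the homogeneous component of degree `n`. -/
def homogMaps (M V : Type*) [AddCommGroup M] [Module ℂ M] [AddCommGroup V] [Module ℂ V] (n : ℕ) :
    Submodule ℂ (M →ₗ[ℂ] Poly V) where
  carrier := {ψ | ∀ v, ψ v ∈ homog V n}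
  add_mem' h₁ h₂ v := add_mem (h₁ v) (h₂ v)
  zero_mem' _ := zero_mem _
  smul_mem' c _ h v := Submodule.smul_mem _ c (h v)

theorem linHom_apply_apply (g : Γ) (ψ : M →ₗ[ℂ] Poly V) (v : M) :
    σ.linHom (polyRep ρ) g ψ v = polyRep ρ g (ψ (σ g⁻¹ v)) := rfl

theorem linHom_avg_equivariant [Fintype Γ] (ψ : M →ₗ[ℂ] Poly V) (g : Γ) (v : M) :
    avg (σ.linHom (polyRep ρ)) ψ (σ g v) = polyRep ρ g (avg (σ.linHom (polyRep ρ)) ψ v) := by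
  have h := LinearMap.congr_fun (apply_avg (σ.linHom (polyRep ρ)) g ψ) (σ g v)
  rw [← h, linHom_apply_apply, ← Module.End.mul_apply, ← map_mul, inv_mul_cancel, map_one,
    Module.End.one_apply]

theorem linHom_avg_mem_homogMaps [Fintype Γ] {n : ℕ} {ψ : M →ₗ[ℂ] Poly V}
    (hψ : ψ ∈ homogMaps M V n) : avg (σ.linHom (polyRep ρ)) ψ ∈ homogMaps M V n :=
  avg_mem _ fun g v => polyHom_homog ρ g n (hψ (σ g⁻¹ v))

/-- An equivariant map to the coinvariants of degree `n` lifts to an equivariant map to `S(V^*)`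
with values of degree `n`. -/
theorem exists_equivariant_lift [Fintype Γ] (n : ℕ)
    (φ : Representation.IntertwiningMap σ (coinvariantPiece ρ n).toRepresentation) :
    ∃ ψ ∈ homogMaps M V n, (∀ g v, ψ (σ g v) = polyRep ρ g (ψ v)) ∧
      toCoinvariants ρ ψ = (coinvariantPiece ρ n).toSubmodule.subtype ∘ₗ φ.toLinearMap := by
  let p : homog V n →ₗ[ℂ] (coinvariantPiece ρ n).toSubmodule :=
    (((hilbertIdeal ρ).restrictScalars ℂ).mkQ ∘ₗ (homog V n).subtype).codRestrict _
      fun f => ⟨f, f.2, rfl⟩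
  have hp : Function.Surjective p := by
    rintro ⟨_, f, hf, rfl⟩
    exact ⟨⟨f, hf⟩, rfl⟩
  obtain ⟨h, hh⟩ := Module.projective_lifting_property p φ.toLinearMap hp
  set ψ₀ : M →ₗ[ℂ] Poly V := (homog V n).subtype ∘ₗ h with hψ₀
  have h0 : toCoinvariants ρ ψ₀ =
      (coinvariantPiece ρ n).toSubmodule.subtype ∘ₗ φ.toLinearMap := by
    rw [← hh]; rfl
  have hq : ∀ v, ((hilbertIdeal ρ).restrictScalars ℂ).mkQ (ψ₀ v) = (φ v).1 := fun v =>
    LinearMap.congr_fun h0 v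
  refine ⟨avg (σ.linHom (polyRep ρ)) ψ₀, linHom_avg_mem_homogMaps fun v => (h v).2,
    linHom_avg_equivariant ψ₀, ?_⟩
  rw [← h0, ← sub_eq_zero, ← map_sub, ← LinearMap.mem_ker]
  refine avg_sub_self_mem _ fun g => ?_
  rw [LinearMap.mem_ker, map_sub, sub_eq_zero]
  ext v
  change ((hilbertIdeal ρ).restrictScalars ℂ).mkQ (polyRep ρ g (ψ₀ (σ g⁻¹ v))) =
    ((hilbertIdeal ρ).restrictScalars ℂ).mkQ (ψ₀ v)
  rw [hq]
  change coinvariantRep ρ g (((hilbertIdeal ρ).restrictScalars ℂ).mkQ (ψ₀ (σ g⁻¹ v))) = _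
  rw [hq]
  have h1 := congrArg Subtype.val
    (Representation.IntertwiningMap.isIntertwining _ _ φ g (σ g⁻¹ v))
  rw [← Module.End.mul_apply, ← map_mul, mul_inv_cancel, map_one, Module.End.one_apply] at h1
  exact h1.symm

/-- As many homogeneous covariants of type `M`, linearly independent modulo the Hilbert ideal, as
the dimension of `M` compute the fake degree of `M`. -/
theorem hasFakeDegrees_of_linearIndependent [Fintype Γ] [FiniteDimensional ℂ V]
    [FiniteDimensional ℂ M] (hρ : GeneratedByReflections ρ) {m : ℕ} (hm : finrank ℂ M = m)
    {ω : Fin m → M →ₗ[ℂ] Poly V} {e : Fin m → ℕ} (hω : ∀ i v, ω i v ∈ homog V (e i))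
    (hσ : ∀ i g v, ω i (σ g v) = polyRep ρ g (ω i v))
    (hind : LinearIndependent ℂ fun i => toCoinvariants ρ (ω i)) :
    HasFakeDegrees ρ σ e := by
  refine ⟨hm, ?_⟩
  ext n
  have hR : PowerSeries.coeff n (∑ i, (PowerSeries.X : PowerSeries ℕ) ^ e i) =
      Fintype.card {i // e i = n} := by
    rw [map_sum, Fintype.card_subtype, Finset.card_filter]
    exact Finset.sum_congr rfl fun i _ => by simp [PowerSeries.coeff_X_pow, eq_comm]
  rw [hR, fakeDegree, PowerSeries.coeff_mk]
  let K : Representation.IntertwiningMap σ (coinvariantPiece ρ n).toRepresentation →ₗ[ℂ]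
      M →ₗ[ℂ] (Poly V ⧸ (hilbertIdeal ρ).restrictScalars ℂ) :=
    { toFun φ := (coinvariantPiece ρ n).toSubmodule.subtype ∘ₗ φ.toLinearMap
      map_add' _ _ := rfl
      map_smul' _ _ := rfl }
  have hK : Function.Injective K := fun φ φ' h => by
    apply Representation.IntertwiningMap.ext
    ext v
    exact LinearMap.congr_fun h v
  have hB : ∀ i : {i // e i = n}, ∃ φ, K φ = toCoinvariants ρ (ω i) := by
    rintro ⟨i, rfl⟩
    refine ⟨⟨(toCoinvariants ρ (ω i)).codRestrict _ fun v => ⟨ω i v, hω i v, rfl⟩, fun g => ?_⟩, ?_⟩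
    · ext v
      exact congrArg ((hilbertIdeal ρ).restrictScalars ℂ).mkQ (hσ i g v)
    · rfl
  choose B hB using hB
  have hli : LinearIndependent ℂ B := by
    apply LinearIndependent.of_comp K
    have : K ∘ B = (fun i => toCoinvariants ρ (ω i)) ∘ Subtype.val := funext hB
    rw [this]
    exact hind.comp _ Subtype.val_injective
  have hspan : ⊤ ≤ Submodule.span ℂ (Set.range B) := by
    intro φ _
    obtain ⟨ψ, hψ, hψσ, hφ⟩ := exists_equivariant_lift n φ
    have h1 : toCoinvariants ρ ψ ∈
        Submodule.span ℂ (Set.range fun i => toCoinvariants ρ (ω i)) := by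
      by_contra hcon
      have h2 : LinearIndependent ℂ fun i => toCoinvariants ρ
          ((Fin.cons ψ ω : Fin (m + 1) → M →ₗ[ℂ] Poly V) i) := by
        have h3 : (fun i => toCoinvariants ρ
            ((Fin.cons ψ ω : Fin (m + 1) → M →ₗ[ℂ] Poly V) i)) =
            Fin.cons (toCoinvariants ρ ψ) fun i => toCoinvariants ρ (ω i) := by
          funext i
          refine Fin.cases ?_ (fun i => ?_) i <;> simp
        rw [h3, linearIndependent_finCons]
        exact ⟨hind, hcon⟩
      have h4 := card_le_finrank_of_linearIndependent hρ (σ := σ)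
        (e := Fin.cons n e) (fun i => by
          refine Fin.cases ?_ (fun i => ?_) i
          · exact hψ
          · simpa using hω i) (fun i => by
          refine Fin.cases ?_ (fun i => ?_) i
          · simpa using hψσ
          · simpa using hσ i) h2
      rw [hm, Fintype.card_fin] at h4
      omega
    obtain ⟨c, hc⟩ := (Submodule.mem_span_range_iff_exists_fun ℂ).1 h1
    -- Only the covariants of degree `n` contribute to a combination of degree `n`.
    have h5 : K φ = K (∑ i : {i // e i = n}, c i • B i) := by
      have h6 : toCoinvariants ρ (∑ i, c i • ω i - ψ) = 0 := by
        rw [map_sub, map_sum, sub_eq_zero, ← hc]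
        simp
      rw [toCoinvariants_eq_zero_iff] at h6
      have h7 : toCoinvariants ρ (∑ i : {i // e i = n}, c i • ω i - ψ) = 0 := by
        rw [toCoinvariants_eq_zero_iff]
        intro v
        have h8 := part_mem_hilbertIdeal ρ (h6 v) n
        convert h8 using 1
        simp only [LinearMap.sub_apply, LinearMap.sum_apply, LinearMap.smul_apply, map_sub,
          map_sum, map_smul, part_of_mem (hψ v)]
        congr 1
        rw [← Finset.sum_subtype (Finset.univ.filter fun i => e i = n) (by simp)
          fun i => c i • ω i v, Finset.sum_filter]
        refine Finset.sum_congr rfl fun i _ => ?_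
        split_ifs with h
        · rw [part_of_mem (h ▸ hω i v)]
        · rw [part_of_mem_ne (hω i v) h, smul_zero]
      rw [map_sub, sub_eq_zero] at h7
      rw [show K φ = toCoinvariants ρ ψ from hφ.symm, ← h7]
      simp [hB]
    rw [hK h5]
    exact Submodule.sum_mem _ fun i _ => Submodule.smul_mem _ _ (Submodule.subset_span ⟨i, rfl⟩)
  rw [finrank_eq_card_basis (Basis.mk hli hspan)]

end FakeDegrees

/-! ### Contraction of covariants -/

section Contraction

variable {Γ V M : Type*} [Group Γ] [AddCommGroup V] [Module ℂ V] [AddCommGroup M] [Module ℂ M]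
  [FiniteDimensional ℂ M] {ρ : Representation ℂ Γ V} {σ : Representation ℂ Γ M}

/-- The contraction `M^* ⊗ S(V^*) → S(V^*)`, `x ⊗ f ↦ t x * f`, where `M^* ⊗ S(V^*)` is identified
with the space of linear maps `M → S(V^*)`. For `M = V` and the inclusion `t` of the linear forms,
the differential of a homogeneous polynomial is sent to a multiple of the polynomial. -/
def contract (t : Dual ℂ M →ₗ[ℂ] Poly V) : (M →ₗ[ℂ] Poly V) →ₗ[ℂ] Poly V :=
  ∑ j, LinearMap.mulLeft ℂ (t ((finBasis ℂ M).coord j)) ∘ₗ LinearMap.applyₗ (finBasis ℂ M j)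

theorem contract_apply (t : Dual ℂ M →ₗ[ℂ] Poly V) (ω : M →ₗ[ℂ] Poly V) :
    contract t ω = ∑ j, t ((finBasis ℂ M).coord j) * ω (finBasis ℂ M j) := by
  simp [contract]

theorem contract_smulRight (t : Dual ℂ M →ₗ[ℂ] Poly V) (x : Dual ℂ M) (f : Poly V) :
    contract t (x.smulRight f) = t x * f := by
  conv_rhs => rw [← (finBasis ℂ M).sum_dual_apply_smul_coord x]
  rw [contract_apply, map_sum, Finset.sum_mul]
  exact Finset.sum_congr rfl fun j _ => by simp

theorem contract_linHom {t : Dual ℂ M →ₗ[ℂ] Poly V}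
    (ht : ∀ g x, t (σ.dual g x) = polyRep ρ g (t x)) (g : Γ) (ω : M →ₗ[ℂ] Poly V) :
    contract t (σ.linHom (polyRep ρ) g ω) = polyRep ρ g (contract t ω) := by
  have h1 : ω = ∑ j, ((finBasis ℂ M).coord j).smulRight (ω (finBasis ℂ M j)) :=
    (finBasis ℂ M).ext fun k => by
      simp [LinearMap.sum_apply, Finsupp.single_apply, ite_smul]
  have h2 : ∀ (x : Dual ℂ M) (f : Poly V), σ.linHom (polyRep ρ) g (x.smulRight f) =
      (σ.dual g x).smulRight (polyRep ρ g f) := fun x f => by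
    ext v
    simp only [linHom_apply_apply, LinearMap.smulRight_apply, map_smul]
    rfl
  rw [h1]
  simp only [map_sum, h2, contract_smulRight, ht, polyRep_mul]

/-- An invariant which is a sum of products of values of `t` and polynomials of degree `n` is the
contraction of a covariant of degree `n`, obtained by averaging. -/
theorem exists_equivariant_contract_eq [Fintype Γ] {t : Dual ℂ M →ₗ[ℂ] Poly V}
    (ht : ∀ g x, t (σ.dual g x) = polyRep ρ g (t x)) {n : ℕ} {f : Poly V}
    (hf : f ∈ invariantRing ρ) (hfn : f ∈ LinearMap.range t * homog V n) :
    ∃ ω : M →ₗ[ℂ] Poly V, (∀ v, ω v ∈ homog V n) ∧ (∀ g v, ω (σ g v) = polyRep ρ g (ω v)) ∧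
      contract t ω = f := by
  obtain ⟨ω, hω, hc⟩ : ∃ ω ∈ homogMaps M V n, contract t ω = f := by
    clear hf
    induction hfn using Submodule.mul_induction_on' with
    | mem_mul_mem a ha b hb =>
      obtain ⟨x, rfl⟩ := ha
      exact ⟨x.smulRight b, fun v => Submodule.smul_mem _ _ hb, contract_smulRight t x b⟩
    | add a _ b _ ha hb =>
      obtain ⟨ω₁, h₁, rfl⟩ := ha
      obtain ⟨ω₂, h₂, rfl⟩ := hb
      exact ⟨ω₁ + ω₂, add_mem h₁ h₂, map_add _ _ _⟩
  refine ⟨avg (σ.linHom (polyRep ρ)) ω, linHom_avg_mem_homogMaps hω, linHom_avg_equivariant ω, ?_⟩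
  rw [avg_apply, map_smul, map_sum]
  simp only [contract_linHom ht, hc]
  rw [← avg_apply, avg_of_invariant _ hf]

/-- Covariants whose contractions are independent modulo the decomposable invariants are independent
modulo the Hilbert ideal. -/
theorem linearIndependent_of_contract [Fintype Γ] {t : Dual ℂ M →ₗ[ℂ] Poly V}
    (ht₀ : ∀ x, part V 0 (t x) = 0) {κ : Type*} [Fintype κ] {ω : κ → M →ₗ[ℂ] Poly V}
    {F : κ → Poly V} (hF : ∀ a, F a ∈ posInv ρ) (hωF : ∀ a, contract t (ω a) = F a)
    (hind : LinearIndependent ℂ fun a => (decomposables ρ).mkQ (F a)) :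
    LinearIndependent ℂ fun a => toCoinvariants ρ (ω a) := by
  rw [linearIndependent_toCoinvariants_iff]
  intro c hc
  refine Fintype.linearIndependent_iff.1 hind c ?_
  have h1 : ∑ a, c a • F a = contract t (∑ a, c a • ω a) := by simp [hωF]
  simp only [← map_smul, ← map_sum]
  rw [Submodule.mkQ_apply, Submodule.Quotient.mk_eq_zero]
  refine mem_decomposables_of_invariant ρ
    (Submodule.sum_mem (Subalgebra.toSubmodule (invariantRing ρ)) fun a _ =>
      Submodule.smul_mem _ _ (hF a).1) ?_
  rw [h1, contract_apply]
  refine Submodule.sum_mem _ fun j _ => ?_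
  have h2 : (∑ a, c a • ω a) (finBasis ℂ M j) ∈ posInv ρ * ⊤ := by
    rw [← hilbertIdeal_eq]
    simpa [LinearMap.sum_apply] using hc (finBasis ℂ M j)
  refine Submodule.mul_induction_on h2 (fun m hm n _ => ?_) fun y z hy hz => ?_
  · rw [mul_left_comm]
    refine Submodule.mul_mem_mul hm ?_
    rw [LinearMap.mem_ker, part_zero_mul, ht₀, zero_mul]
  · rw [mul_add]
    exact add_mem hy hz

/-- If `dim M` homogeneous invariants are independent modulo the decomposable ones and each is a
combination of values of `t` with coefficients of a fixed degree `e i`, then these degrees give the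
fake degree of `M`. -/
theorem hasFakeDegrees_of_indecomposable [Finite Γ] [FiniteDimensional ℂ V]
    (hρ : GeneratedByReflections ρ) {t : Dual ℂ M →ₗ[ℂ] Poly V}
    (ht : ∀ g x, t (σ.dual g x) = polyRep ρ g (t x)) (ht₀ : ∀ x, part V 0 (t x) = 0) {m : ℕ}
    (hm : finrank ℂ M = m) {F : Fin m → Poly V} {e : Fin m → ℕ} (hF : ∀ i, F i ∈ posInv ρ)
    (hFe : ∀ i, F i ∈ LinearMap.range t * homog V (e i))
    (hind : LinearIndependent ℂ fun i => (decomposables ρ).mkQ (F i)) :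
    HasFakeDegrees ρ σ e := by
  cases nonempty_fintype Γ
  choose ω h1 h2 h3 using fun i => exists_equivariant_contract_eq ht (hF i).1 (hFe i)
  exact hasFakeDegrees_of_linearIndependent hρ hm h1 h2
    (linearIndependent_of_contract ht₀ hF h3 hind)

theorem part_zero_ι (x : Dual ℂ V) : part V 0 (SymmetricAlgebra.ι ℂ _ x) = 0 :=
  part_of_mem_ne (ι_mem_homog x) one_ne_zero

theorem pos_of_linearIndependent {κ : Type*} {F : κ → Poly V} {d : κ → ℕ}
    (hF : ∀ a, F a ∈ posInv ρ) (hd : ∀ a, F a ∈ homog V (d a))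
    (hind : LinearIndependent ℂ fun a => (decomposables ρ).mkQ (F a)) (a : κ) : 0 < d a := by
  rcases Nat.eq_zero_or_pos (d a) with h | h
  · have h1 := ((mem_posInv ρ).1 (hF a)).2
    rw [part_of_mem (h ▸ hd a)] at h1
    exact absurd (by rw [h1, map_zero]) (hind.ne_zero a)
  · exact h

/-- There are at most `dim V` homogeneous invariants which are linearly independent modulo the
decomposable ones: each is the contraction of a covariant of type `V`. -/
theorem card_le_of_linearIndependent_decomposables [Finite Γ] [FiniteDimensional ℂ V]
    (hρ : GeneratedByReflections ρ) {κ : Type*} [Fintype κ] {F : κ → Poly V} {d : κ → ℕ}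
    (hF : ∀ a, F a ∈ posInv ρ) (hd : ∀ a, F a ∈ homog V (d a))
    (hind : LinearIndependent ℂ fun a => (decomposables ρ).mkQ (F a)) :
    Fintype.card κ ≤ finrank ℂ V := by
  cases nonempty_fintype Γ
  have hFe : ∀ a, F a ∈ LinearMap.range (SymmetricAlgebra.ι ℂ (Dual ℂ V)) * homog V (d a - 1) := by
    intro a
    rw [← homog_succ, Nat.sub_add_cancel (pos_of_linearIndependent hF hd hind a)]
    exact hd a
  choose ω h1 h2 h3 using fun a => exists_equivariant_contract_eq (σ := ρ)
    (fun g x => (polyRep_ι ρ g x).symm) (hF a).1 (hFe a)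
  exact card_le_finrank_of_linearIndependent hρ h1 h2
    (linearIndependent_of_contract part_zero_ι hF h3 hind)

end Contraction

/-! ### Integrality and transcendence degree -/

section Integrality

variable {Γ V : Type*} [Group Γ] [AddCommGroup V] [Module ℂ V] (ρ : Representation ℂ Γ V)

/-- The action of the group on `S(V^*)` by ring automorphisms. -/
abbrev polyAction : MulSemiringAction Γ (Poly V) where
  smul g f := polyHom ρ g f
  one_smul f := by change polyHom ρ 1 f = f; rw [polyHom_one]; rfl
  mul_smul g h f := by change polyHom ρ (g * h) f = _; rw [polyHom_mul]; rfl
  smul_zero g := map_zero (polyHom ρ g)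
  smul_add g := map_add (polyHom ρ g)
  smul_one g := map_one (polyHom ρ g)
  smul_mul g := map_mul (polyHom ρ g)

theorem isIntegral_invariantRing [Finite Γ] : Algebra.IsIntegral (invariantRing ρ) (Poly V) := by
  let _ := polyAction ρ
  have : Algebra.IsInvariant (invariantRing ρ) (Poly V) Γ := ⟨fun b hb => ⟨⟨b, hb⟩, rfl⟩⟩
  exact Algebra.IsInvariant.isIntegral (invariantRing ρ) (Poly V) Γ

variable [FiniteDimensional ℂ V] {κ : Type*} [Fintype κ] {y : κ → Poly V}

variable (V) in
theorem finrank_le_trdeg : (finrank ℂ V : Cardinal) ≤ Algebra.trdeg ℂ (Poly V) := by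
  let b := finBasis ℂ (Dual ℂ V)
  have h : AlgebraicIndependent ℂ ((SymmetricAlgebra.equivMvPolynomial b).symm.toAlgHom ∘
      (MvPolynomial.X : Fin (finrank ℂ (Dual ℂ V)) → MvPolynomial _ ℂ)) :=
    (MvPolynomial.algebraicIndependent_X _ ℂ).map'
      (SymmetricAlgebra.equivMvPolynomial b).symm.injective
  have h2 := h.lift_cardinalMk_le_trdeg
  simpa [Subspace.dual_finrank_eq] using h2

theorem finrank_le_card_of_isIntegral
    (h : Algebra.IsIntegral (Algebra.adjoin ℂ (Set.range y)) (Poly V)) :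
    finrank ℂ V ≤ Fintype.card κ := by
  have h1 := Algebra.IsAlgebraic.trdeg_le_cardinalMk ℂ (A := Poly V) (Set.range y)
  have h2 := (finrank_le_trdeg V).trans h1
  classical
  rw [Cardinal.mk_fintype] at h2
  exact (Nat.cast_le.1 h2).trans (Fintype.card_range_le y)

theorem algebraicIndependent_of_isIntegral
    (h : Algebra.IsIntegral (Algebra.adjoin ℂ (Set.range y)) (Poly V))
    (hc : Fintype.card κ = finrank ℂ V) : AlgebraicIndependent ℂ y := by
  refine (Algebra.IsAlgebraic.isTranscendenceBasis_of_lift_le_trdeg_of_finite ℂ y ?_).1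
  simpa [hc] using finrank_le_trdeg V

end Integrality

/-! ### Polynomiality of the ring of invariants -/

section Generators

variable {Γ V : Type*} [Group Γ] [AddCommGroup V] [Module ℂ V] {ρ : Representation ℂ Γ V}

section Span

variable {κ : Type*} {F : κ → Poly V}

/-- Homogeneous invariants spanning the invariants without constant term modulo the decomposable
ones generate the ring of invariants. -/
theorem adjoin_eq_of_posInv_le {d : κ → ℕ} (hF : ∀ a, F a ∈ posInv ρ)
    (hd : ∀ a, F a ∈ homog V (d a))
    (h : posInv ρ ≤ Submodule.span ℂ (Set.range F) ⊔ decomposables ρ) :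
    Algebra.adjoin ℂ (Set.range F) = invariantRing ρ := by
  apply le_antisymm
  · refine Algebra.adjoin_le ?_
    rintro _ ⟨a, rfl⟩
    exact (hF a).1
  · have key : ∀ n, ∀ f ∈ invariantRing ρ, f ∈ homog V n →
        f ∈ Algebra.adjoin ℂ (Set.range F) := by
      intro n
      induction n using Nat.strong_induction_on with
      | _ n ih =>
        intro f hf hfn
        rcases Nat.eq_zero_or_pos n with rfl | hn
        · obtain ⟨c, rfl⟩ := exists_eq_algebraMap_of_mem_homog_zero hfn
          exact Subalgebra.algebraMap_mem _ c
        obtain ⟨x, hx, z, hz, rfl⟩ := Submodule.mem_sup.1 (h (mem_posInv_of_mem_homog ρ hf hfn hn))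
        rw [← part_of_mem hfn, map_add]
        refine add_mem ?_ ?_
        · clear hf hfn
          induction hx using Submodule.span_induction with
          | mem x hx =>
            obtain ⟨a, rfl⟩ := hx
            by_cases hdn : d a = n
            · rw [part_of_mem (hdn ▸ hd a)]
              exact Algebra.subset_adjoin ⟨a, rfl⟩
            · rw [part_of_mem_ne (hd a) hdn]
              exact zero_mem _
          | zero => rw [map_zero]; exact zero_mem _
          | add x y _ _ hx hy => rw [map_add]; exact add_mem hx hy
          | smul c x _ hx => rw [map_smul]; exact Subalgebra.smul_mem _ hx c
        · clear hf hfn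
          unfold decomposables at hz
          induction hz using Submodule.mul_induction_on' with
          | mem_mul_mem a ha b hb =>
            obtain ⟨s, hs⟩ := exists_eq_sum_part a
            rw [hs, Finset.sum_mul, map_sum]
            refine sum_mem fun k _ => ?_
            rcases lt_or_ge n k with hk | hk
            · rw [part_mul_of_lt (part_mem k a) hk]; exact zero_mem _
            obtain ⟨m, rfl⟩ := Nat.exists_eq_add_of_le hk
            rw [part_mul_of_mem (part_mem k a)]
            -- The components of degree zero vanish, so that both factors have smaller degree.
            rcases Nat.eq_zero_or_pos k with rfl | hk0
            · rw [((mem_posInv ρ).1 ha).2, zero_mul]; exact zero_mem _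
            rcases Nat.eq_zero_or_pos m with rfl | hm0
            · rw [((mem_posInv ρ).1 hb).2, mul_zero]; exact zero_mem _
            exact mul_mem
              (ih k (by omega) _ (part_mem_invariantRing ρ ha.1 k) (part_mem k a))
              (ih m (by omega) _ (part_mem_invariantRing ρ hb.1 m) (part_mem m b))
          | add x _ y _ hx hy => rw [map_add]; exact add_mem hx hy
    intro f hf
    exact mem_of_part_mem (S := Subalgebra.toSubmodule (Algebra.adjoin ℂ (Set.range F)))
      fun n => key n _ (part_mem_invariantRing ρ hf n) (part_mem n f)

theorem posInv_le_of_adjoin_eq (hF : ∀ a, F a ∈ posInv ρ)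
    (h : Algebra.adjoin ℂ (Set.range F) = invariantRing ρ) :
    posInv ρ ≤ Submodule.span ℂ (Set.range F) ⊔ decomposables ρ := by
  set P := Submodule.span ℂ (Set.range F) ⊔ decomposables ρ with hP
  have hle : P ≤ posInv ρ := by
    refine sup_le (Submodule.span_le.2 ?_) (decomposables_le_posInv ρ)
    rintro _ ⟨a, rfl⟩
    exact hF a
  have key : ∀ f ∈ Algebra.adjoin ℂ (Set.range F), ∃ c : ℂ, f - algebraMap ℂ _ c ∈ P := by
    intro f hf
    induction hf using Algebra.adjoin_induction with
    | mem x hx => exact ⟨0, by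
        rw [map_zero, sub_zero]; exact Submodule.mem_sup_left (Submodule.subset_span hx)⟩
    | algebraMap c => exact ⟨c, by rw [sub_self]; exact zero_mem _⟩
    | add x y _ _ hx hy =>
      obtain ⟨c, hc⟩ := hx
      obtain ⟨c', hc'⟩ := hy
      refine ⟨c + c', ?_⟩
      rw [map_add, add_sub_add_comm]
      exact add_mem hc hc'
    | mul x y _ _ hx hy =>
      obtain ⟨c, hc⟩ := hx
      obtain ⟨c', hc'⟩ := hy
      refine ⟨c * c', ?_⟩
      have h1 : x * y - algebraMap ℂ (Poly V) (c * c') =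
          (x - algebraMap ℂ _ c) * (y - algebraMap ℂ _ c') + c • (y - algebraMap ℂ _ c') +
            c' • (x - algebraMap ℂ _ c) := by
        rw [Algebra.smul_def, Algebra.smul_def, map_mul]; ring
      rw [h1]
      refine add_mem (add_mem (Submodule.mem_sup_right ?_) (P.smul_mem _ hc')) (P.smul_mem _ hc)
      exact Submodule.mul_mem_mul (hle hc) (hle hc')
  intro f hf
  obtain ⟨c, hc⟩ := key f (h ▸ hf.1)
  have h1 := ((mem_posInv ρ).1 (hle hc)).2
  rw [map_sub, ((mem_posInv ρ).1 hf).2, part_zero_algebraMap, zero_sub, neg_eq_zero] at h1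
  rwa [h1, sub_zero] at hc

theorem mem_sup_decomposables_iff {f : Poly V} :
    f ∈ Submodule.span ℂ (Set.range F) ⊔ decomposables ρ ↔
      (decomposables ρ).mkQ f ∈
        Submodule.span ℂ (Set.range fun a => (decomposables ρ).mkQ (F a)) := by
  have h1 : (Set.range fun a => (decomposables ρ).mkQ (F a)) =
      (decomposables ρ).mkQ '' Set.range F := by
    rw [← Set.range_comp]; rfl
  rw [h1, Submodule.span_image, sup_comm, ← Submodule.comap_map_mkQ, Submodule.mem_comap]

end Span

namespace IsFundamentalInvariants

variable {r : ℕ} {F : Fin r → Poly V} {d : Fin r → ℕ}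

theorem pos (h : IsFundamentalInvariants ρ F d) (i : Fin r) : 0 < d i := by
  rcases Nat.eq_zero_or_pos (d i) with h0 | h0
  · obtain ⟨c, hc⟩ := exists_eq_algebraMap_of_mem_homog_zero (h0 ▸ h.homogeneous i)
    exact absurd (hc ▸ isAlgebraic_algebraMap c) (h.algebraicIndependent.transcendental i)
  · exact h0

theorem mem_posInv (h : IsFundamentalInvariants ρ F d) (i : Fin r) : F i ∈ posInv ρ := by
  refine mem_posInv_of_mem_homog ρ ?_ (h.homogeneous i) (h.pos i)
  rw [← h.generate]
  exact Algebra.subset_adjoin ⟨i, rfl⟩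

end IsFundamentalInvariants

variable [Finite Γ] [FiniteDimensional ℂ V] {κ : Type*} [Fintype κ] {F : κ → Poly V} {d : κ → ℕ}

/-- Homogeneous generators of the ring of invariants, as many as the dimension, are linearly
independent modulo the decomposable invariants: fewer of them cannot generate. -/
theorem linearIndependent_of_adjoin_eq (hF : ∀ a, F a ∈ posInv ρ) (hd : ∀ a, F a ∈ homog V (d a))
    (h : Algebra.adjoin ℂ (Set.range F) = invariantRing ρ)
    (hc : Fintype.card κ = finrank ℂ V) :
    LinearIndependent ℂ fun a => (decomposables ρ).mkQ (F a) := by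
  obtain ⟨κ', a, ha, hspan, hli⟩ :=
    exists_linearIndependent' ℂ fun a => (decomposables ρ).mkQ (F a)
  have : Finite κ' := Finite.of_injective a ha
  cases nonempty_fintype κ'
  have h1 : posInv ρ ≤ Submodule.span ℂ (Set.range (F ∘ a)) ⊔ decomposables ρ := by
    intro f hf
    have h2 := mem_sup_decomposables_iff.1 (posInv_le_of_adjoin_eq hF h hf)
    rw [← hspan] at h2
    exact mem_sup_decomposables_iff.2 h2
  have h3 := adjoin_eq_of_posInv_le (fun b => hF (a b)) (fun b => hd (a b)) h1
  have h4 : finrank ℂ V ≤ Fintype.card κ' := by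
    apply finrank_le_card_of_isIntegral (y := fun b => F (a b))
    rw [h3]
    exact isIntegral_invariantRing ρ
  have h5 : Function.Bijective a :=
    (Fintype.bijective_iff_injective_and_card a).2
      ⟨ha, le_antisymm (Fintype.card_le_of_injective a ha) (hc ▸ h4)⟩
  have h6 : (fun a => (decomposables ρ).mkQ (F a)) =
      ((fun a => (decomposables ρ).mkQ (F a)) ∘ a) ∘ (Equiv.ofBijective a h5).symm :=
    funext fun b => congrArg (fun b => (decomposables ρ).mkQ (F b))
      ((Equiv.ofBijective a h5).apply_symm_apply b).symm
  rw [h6]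
  exact hli.comp _ (Equiv.injective _)

theorem algebraicIndependent_of_adjoin_eq (h : Algebra.adjoin ℂ (Set.range F) = invariantRing ρ)
    (hc : Fintype.card κ = finrank ℂ V) : AlgebraicIndependent ℂ F := by
  refine algebraicIndependent_of_isIntegral ?_ hc
  rw [h]
  exact isIntegral_invariantRing ρ

/-- Homogeneous invariants, as many as the dimension, which are linearly independent modulo the
decomposable ones generate the ring of invariants of a reflection group, as there is no larger
independent family. -/
theorem adjoin_eq_of_linearIndependent (hρ : GeneratedByReflections ρ)
    (hF : ∀ a, F a ∈ posInv ρ) (hd : ∀ a, F a ∈ homog V (d a))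
    (hind : LinearIndependent ℂ fun a => (decomposables ρ).mkQ (F a))
    (hc : Fintype.card κ = finrank ℂ V) :
    Algebra.adjoin ℂ (Set.range F) = invariantRing ρ := by
  refine adjoin_eq_of_posInv_le hF hd fun f hf => mem_of_part_mem fun n => ?_
  rw [mem_sup_decomposables_iff]
  by_contra hcon
  have h1 : LinearIndependent ℂ fun a : Option κ =>
      (decomposables ρ).mkQ (a.elim (part V n f) F) := by
    rw [linearIndependent_option]
    exact ⟨hind, hcon⟩
  have h2 := card_le_of_linearIndependent_decomposables hρ (d := fun a => a.elim n d)
    (by rintro (_ | a); exacts [part_mem_posInv ρ hf n, hF a])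
    (by rintro (_ | a); exacts [part_mem n f, hd a]) h1
  rw [Fintype.card_option, hc] at h2
  omega

/-- A reflection group has as many homogeneous invariants, linearly independent modulo the
decomposable ones, as the dimension. -/
theorem exists_linearIndependent_decomposables (hρ : GeneratedByReflections ρ) {ι : Type*}
    [Fintype ι] (hι : Fintype.card ι = finrank ℂ V) :
    ∃ (F : ι → Poly V) (d : ι → ℕ), (∀ i, F i ∈ posInv ρ) ∧ (∀ i, F i ∈ homog V (d i)) ∧
      LinearIndependent ℂ fun i => (decomposables ρ).mkQ (F i) := by
  obtain ⟨κ, a, ha, hspan, hli⟩ := exists_linearIndependent' ℂ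
    fun p : {p : ℕ × Poly V // p.2 ∈ posInv ρ ∧ p.2 ∈ homog V p.1} =>
      (decomposables ρ).mkQ p.1.2
  have hF : ∀ b, (a b).1.2 ∈ posInv ρ := fun b => (a b).2.1
  have hd : ∀ b, (a b).1.2 ∈ homog V (a b).1.1 := fun b => (a b).2.2
  have hfin : Finite κ := by
    by_contra hinf
    rw [not_finite_iff_infinite] at hinf
    obtain ⟨s, hs⟩ := Infinite.exists_subset_card_eq κ (finrank ℂ V + 1)
    have h1 := card_le_of_linearIndependent_decomposables hρ (κ := s) (fun b => hF b)
      (fun b => hd b) (hli.comp _ Subtype.val_injective)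
    rw [Fintype.card_coe, hs] at h1
    omega
  cases nonempty_fintype κ
  have h1 : posInv ρ ≤ Submodule.span ℂ (Set.range fun b => (a b).1.2) ⊔ decomposables ρ := by
    intro f hf
    refine mem_of_part_mem fun n => mem_sup_decomposables_iff.2 ?_
    have h2 : Submodule.span ℂ (Set.range fun b => (decomposables ρ).mkQ (a b).1.2) = _ := hspan
    rw [h2]
    exact Submodule.subset_span ⟨⟨(n, part V n f), part_mem_posInv ρ hf n, part_mem n f⟩, rfl⟩
  have h2 := adjoin_eq_of_posInv_le hF hd h1
  have h3 : finrank ℂ V ≤ Fintype.card κ := by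
    apply finrank_le_card_of_isIntegral (y := fun b => (a b).1.2)
    rw [h2]
    exact isIntegral_invariantRing ρ
  have h4 := card_le_of_linearIndependent_decomposables hρ hF hd hli
  let eq : ι ≃ κ := Fintype.equivOfCardEq (by omega)
  exact ⟨fun i => (a (eq i)).1.2, fun i => (a (eq i)).1.1, fun i => hF _, fun i => hd _,
    hli.comp _ eq.injective⟩

theorem isFundamentalInvariants_of_linearIndependent (hρ : GeneratedByReflections ρ) {r : ℕ}
    (hr : finrank ℂ V = r) {F : Fin r → Poly V} {d : Fin r → ℕ}
    (hF : ∀ i, F i ∈ posInv ρ) (hd : ∀ i, F i ∈ homog V (d i))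
    (hind : LinearIndependent ℂ fun i => (decomposables ρ).mkQ (F i)) :
    IsFundamentalInvariants ρ F d := by
  have hc : Fintype.card (Fin r) = finrank ℂ V := by rw [Fintype.card_fin, hr]
  have h := adjoin_eq_of_linearIndependent hρ hF hd hind hc
  exact ⟨hr, hd, algebraicIndependent_of_adjoin_eq h hc, h⟩

namespace IsFundamentalInvariants

variable {r : ℕ} {F : Fin r → Poly V} {d : Fin r → ℕ}

theorem linearIndependent (h : IsFundamentalInvariants ρ F d) :
    LinearIndependent ℂ fun i => (decomposables ρ).mkQ (F i) :=
  linearIndependent_of_adjoin_eq h.mem_posInv h.homogeneous h.generate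
    (by rw [Fintype.card_fin, h.dim])

/-- The fake degree of the reflection representation is given by the degrees shifted by one. -/
theorem hasFakeDegrees (h : IsFundamentalInvariants ρ F d) (hρ : GeneratedByReflections ρ)
    {e : Fin r → ℕ} (he : ∀ i, e i + 1 = d i) : HasFakeDegrees ρ ρ e :=
  hasFakeDegrees_of_indecomposable hρ (fun g x => (polyRep_ι ρ g x).symm) part_zero_ι h.dim
    h.mem_posInv (fun i => by rw [← homog_succ, he]; exact h.homogeneous i) h.linearIndependent

end IsFundamentalInvariants

end Generators

/-! ### Stable systems of fundamental invariants of a normal subgroup -/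

section Existence

variable {Γ V : Type*} [Group Γ] [AddCommGroup V] [Module ℂ V] {ρ : Representation ℂ Γ V}
  {N : Subgroup Γ}

theorem polyRep_comp_subtype (n : N) : polyRep (ρ.comp N.subtype) n = polyRep ρ (n : Γ) := rfl

variable [N.Normal]

theorem polyRep_mem_invariantRing (g : Γ) {f : Poly V}
    (hf : f ∈ invariantRing (ρ.comp N.subtype)) :
    polyRep ρ g f ∈ invariantRing (ρ.comp N.subtype) := fun n => by
  have h1 : (n : Γ) * g = g * (g⁻¹ * n * g) := by group
  have h2 : g⁻¹ * n * g ∈ N := by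
    simpa using (inferInstance : N.Normal).conj_mem n n.2 g⁻¹
  have h3 : polyRep ρ (g⁻¹ * n * g) f = f := hf ⟨_, h2⟩
  rw [polyRep_comp_subtype, ← Module.End.mul_apply, ← map_mul, h1, map_mul, Module.End.mul_apply,
    h3]

theorem polyRep_mem_posInv (g : Γ) {f : Poly V} (hf : f ∈ posInv (ρ.comp N.subtype)) :
    polyRep ρ g f ∈ posInv (ρ.comp N.subtype) := by
  refine ⟨polyRep_mem_invariantRing g hf.1, ?_⟩
  change part V 0 (polyRep ρ g f) = 0
  rw [part_polyRep, LinearMap.mem_ker.1 hf.2, map_zero]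

theorem polyRep_mem_decomposables (g : Γ) {f : Poly V}
    (hf : f ∈ decomposables (ρ.comp N.subtype)) :
    polyRep ρ g f ∈ decomposables (ρ.comp N.subtype) := by
  unfold decomposables at hf
  induction hf using Submodule.mul_induction_on' with
  | mem_mul_mem a ha b hb =>
    rw [polyRep_mul]
    exact Submodule.mul_mem_mul (polyRep_mem_posInv g ha) (polyRep_mem_posInv g hb)
  | add x _ y _ hx hy => rw [map_add]; exact add_mem hx hy

/-- Averaging the projection onto the span of fundamental invariants along the decomposable
invariants gives an equivariant projection, whose image is spanned by fundamental invariants. -/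
theorem nonempty_quotientSpace [Finite Γ] [FiniteDimensional ℂ V]
    (hN : GeneratedByReflections (ρ.comp N.subtype)) : Nonempty (QuotientSpace ρ N) := by
  cases nonempty_fintype Γ
  set D := decomposables (ρ.comp N.subtype) with hD
  set P := posInv (ρ.comp N.subtype) with hP
  set r := finrank ℂ V with hr
  obtain ⟨F, d, hF, hd, hind⟩ := exists_linearIndependent_decomposables hN
    (ι := Fin r) (Fintype.card_fin _)
  have hsup : P ≤ Submodule.span ℂ (Set.range F) ⊔ D := posInv_le_of_adjoin_eq hF
    (adjoin_eq_of_linearIndependent hN hF hd hind (Fintype.card_fin _))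
  obtain ⟨p, hp⟩ := LinearMap.exists_leftInverse_of_injective
    (Fintype.linearCombination ℂ fun i => D.mkQ (F i))
    (LinearMap.ker_eq_bot'.2 fun c hc => funext (Fintype.linearIndependent_iff.1 hind c hc))
  have hpF : ∀ j, p (D.mkQ (F j)) = Pi.single j 1 := fun j => by
    have := LinearMap.congr_fun hp (Pi.single j 1)
    simpa [Fintype.linearCombination_apply_single] using this
  let π : Poly V →ₗ[ℂ] Poly V := ∑ i, LinearMap.toSpanSingleton ℂ _ (F i) ∘ₗ
    LinearMap.proj i ∘ₗ p ∘ₗ D.mkQ ∘ₗ part V (d i)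
  have hπ : ∀ x, π x = ∑ i, p (D.mkQ (part V (d i) x)) i • F i := fun x => by
    simp [π, LinearMap.sum_apply]
  have hπF : ∀ j, π (F j) = F j := fun j => by
    rw [hπ, Finset.sum_eq_single j, part_of_mem (hd j), hpF, Pi.single_eq_same, one_smul]
    · intro i _ hij
      by_cases h : d j = d i
      · rw [part_of_mem (h ▸ hd j), hpF, Pi.single_eq_of_ne hij, zero_smul]
      · rw [part_of_mem_ne (hd j) h, map_zero, map_zero, Pi.zero_apply, zero_smul]
    · simp
  have hπspan : ∀ y ∈ Submodule.span ℂ (Set.range F), π y = y := by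
    intro y hy
    have : Set.EqOn π LinearMap.id (Submodule.span ℂ (Set.range F)) :=
      LinearMap.eqOn_span (by rintro _ ⟨j, rfl⟩; exact hπF j)
    exact this hy
  have hπD : ∀ x ∈ D, π x = 0 := fun x hx => by
    rw [hπ]
    refine Finset.sum_eq_zero fun i _ => ?_
    have h1 : D.mkQ (part V (d i) x) = 0 := by
      rw [Submodule.mkQ_apply, Submodule.Quotient.mk_eq_zero]
      exact part_mem_decomposables _ hx _
    rw [h1, map_zero, Pi.zero_apply, zero_smul]
  have hπP : ∀ x ∈ P, π x - x ∈ D := fun x hx => by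
    obtain ⟨y, hy, z, hz, rfl⟩ := Submodule.mem_sup.1 (hsup hx)
    rw [map_add, hπspan y hy, hπD z hz, add_zero, sub_add_cancel_left]
    exact neg_mem hz
  have hπhomog : ∀ n, ∀ x ∈ homog V n, π x ∈ homog V n := fun n x hx => by
    rw [hπ]
    refine Submodule.sum_mem _ fun i _ => ?_
    by_cases h : d i = n
    · exact Submodule.smul_mem _ _ (h ▸ hd i)
    · rw [part_of_mem_ne hx (Ne.symm h), map_zero, map_zero, Pi.zero_apply, zero_smul]
      exact zero_mem _
  have hπpos : ∀ x, π x ∈ P := fun x => by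
    rw [hπ]
    exact Submodule.sum_mem _ fun i _ => Submodule.smul_mem _ _ (hF i)
  set T := avg ((polyRep ρ).linHom (polyRep ρ)) π with hT
  have hTg : ∀ g x, T (polyRep ρ g x) = polyRep ρ g (T x) := linHom_avg_equivariant π
  have hThomog : ∀ n, T ∈ Submodule.compatibleMaps (homog V n) (homog V n) := fun n =>
    avg_mem _ fun g x hx =>
      polyHom_homog ρ g n (hπhomog n _ (polyHom_homog ρ g⁻¹ n hx))
  have hTpos : T ∈ Submodule.compatibleMaps ⊤ P :=
    avg_mem _ fun g x _ => polyRep_mem_posInv g (hπpos _)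
  have hTD : T ∈ Submodule.compatibleMaps D ⊥ :=
    avg_mem _ fun g x hx => by
      rw [Submodule.mem_comap, linHom_apply_apply, hπD _ (polyRep_mem_decomposables g⁻¹ hx),
        map_zero]
      exact zero_mem _
  have hTπ : T - π ∈ Submodule.compatibleMaps P D :=
    avg_sub_self_mem _ fun g x hx => by
      rw [Submodule.mem_comap, LinearMap.sub_apply, linHom_apply_apply]
      have h1 := polyRep_mem_decomposables g (hπP _ (polyRep_mem_posInv g⁻¹ hx))
      rw [map_sub, ← Module.End.mul_apply (polyRep ρ g) (polyRep ρ g⁻¹), ← map_mul, mul_inv_cancel,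
        map_one, Module.End.one_apply] at h1
      simpa using sub_mem h1 (hπP x hx)
  have hTF : ∀ i, D.mkQ (T (F i)) = D.mkQ (F i) := fun i => by
    rw [← sub_eq_zero, ← map_sub, Submodule.mkQ_apply, Submodule.Quotient.mk_eq_zero]
    have h1 : (T - π) (F i) ∈ D := hTπ (hF i)
    rwa [LinearMap.sub_apply, hπF] at h1
  have hind' : LinearIndependent ℂ fun i => D.mkQ (T (F i)) := by simpa only [hTF] using hind
  have hfund : IsFundamentalInvariants (ρ.comp N.subtype) (fun i => T (F i)) d :=
    isFundamentalInvariants_of_linearIndependent hN rfl (fun i => hTpos trivial)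
      (fun i => hThomog _ (hd i)) hind'
  have hTspan : ∀ x ∈ P, T x ∈ Submodule.span ℂ (Set.range fun i => T (F i)) := fun x hx => by
    obtain ⟨y, hy, z, hz, rfl⟩ := Submodule.mem_sup.1 (hsup hx)
    have h1 : T z = 0 := hTD hz
    have h2 : (Set.range fun i => T (F i)) = T '' Set.range F := by
      rw [← Set.range_comp]; rfl
    rw [map_add, h1, add_zero, h2, Submodule.span_image]
    exact Submodule.mem_map_of_mem hy
  refine ⟨⟨⟨Submodule.span ℂ (Set.range fun i => T (F i)), fun g v hv => ?_⟩, r, _, d, hfund, rfl⟩⟩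
  induction hv using Submodule.span_induction with
  | mem x hx =>
    obtain ⟨i, rfl⟩ := hx
    rw [← hTg]
    exact hTspan _ (polyRep_mem_posInv g (hF i))
  | zero => rw [map_zero]; exact zero_mem _
  | add x y _ _ hx hy => rw [map_add]; exact add_mem hx hy
  | smul c x _ hx => rw [map_smul]; exact Submodule.smul_mem _ _ hx

end Existence

/-! ### Reflections -/

section Reflections

theorem closure_eq_top_of_injective {Γ Δ : Type*} [Group Γ] [Group Δ] {f : Γ →* Δ}
    (hf : Function.Injective f) {S : Set Δ} {X : Set Γ} (h : Subgroup.closure S = f.range)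
    (hS : S ⊆ f '' X) : Subgroup.closure X = ⊤ := by
  refine eq_top_iff.2 fun g _ => ?_
  have h1 : f g ∈ (Subgroup.closure X).map f := by
    rw [MonoidHom.map_closure]
    refine Subgroup.closure_mono hS ?_
    rw [h]
    exact ⟨g, rfl⟩
  obtain ⟨g', hg', hgg⟩ := h1
  rwa [← hf hgg]

variable {Γ V : Type*} [Group Γ] [AddCommGroup V] [Module ℂ V]

theorem finrank_range_dual_sub_one_le [FiniteDimensional ℂ V] {ρ : Representation ℂ Γ V} {g : Γ}
    {L : Submodule ℂ V}
    (hL : finrank ℂ L + 1 = finrank ℂ V) (hg : ∀ v ∈ L, ρ g v = v) :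
    finrank ℂ (LinearMap.range (ρ.dual g - 1)) ≤ 1 := by
  have h1 : LinearMap.range (ρ.dual g - 1) ≤ L.dualAnnihilator := by
    rintro _ ⟨x, rfl⟩
    rw [Submodule.mem_dualAnnihilator]
    intro v hv
    have h2 : ρ g⁻¹ v = v := by
      conv_lhs => rw [← hg v hv]
      rw [← Module.End.mul_apply, ← map_mul, inv_mul_cancel, map_one, Module.End.one_apply]
    change x (ρ g⁻¹ v) - x v = 0
    rw [h2, sub_self]
  have h2 := Submodule.finrank_mono h1
  have h3 := Subspace.finrank_add_finrank_dualAnnihilator_eq L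
  omega

theorem dual_dual_eval {τ : Representation ℂ Γ V} (g : Γ) (v : V) :
    τ.dual.dual g (Dual.eval ℂ V v) = Dual.eval ℂ V (τ g v) := by
  ext x
  change x (τ g⁻¹⁻¹ v) = x (τ g v)
  rw [inv_inv]

theorem finrank_range_dual_dual_sub_one [FiniteDimensional ℂ V] (τ : Representation ℂ Γ V) (g : Γ) :
    finrank ℂ (LinearMap.range (τ.dual.dual g - 1)) ≤ finrank ℂ (LinearMap.range (τ g - 1)) := by
  have h1 : LinearMap.range (τ.dual.dual g - 1) ≤
      (LinearMap.range (τ g - 1)).map (Dual.eval ℂ V) := by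
    rintro _ ⟨x, rfl⟩
    obtain ⟨v, rfl⟩ := (evalEquiv ℂ V).surjective x
    refine ⟨τ g v - v, ⟨v, rfl⟩, ?_⟩
    rw [map_sub, ← dual_dual_eval]
    rfl
  exact (Submodule.finrank_mono h1).trans (Submodule.finrank_map_le _ _)

/-- The restriction of polynomial functions to a subspace. -/
def restrict (L : Submodule ℂ V) : Poly V →ₐ[ℂ] Poly L :=
  SymmetricAlgebra.lift (SymmetricAlgebra.ι ℂ (Dual ℂ L) ∘ₗ L.subtype.dualMap)

theorem restrict_ι (L : Submodule ℂ V) (x : Dual ℂ V) :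
    restrict L (SymmetricAlgebra.ι ℂ _ x) = SymmetricAlgebra.ι ℂ _ (L.subtype.dualMap x) := by
  simp [restrict]

theorem restrict_surjective (L : Submodule ℂ V) : Function.Surjective (restrict L) := by
  intro f
  induction f using SymmetricAlgebra.induction with
  | algebraMap c => exact ⟨algebraMap ℂ _ c, AlgHom.commutes _ c⟩
  | ι x =>
    obtain ⟨y, rfl⟩ := LinearMap.dualMap_surjective_of_injective L.subtype_injective x
    exact ⟨_, restrict_ι L y⟩
  | mul a b ha hb =>
    obtain ⟨a, rfl⟩ := ha
    obtain ⟨b, rfl⟩ := hb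
    exact ⟨a * b, map_mul _ a b⟩
  | add a b ha hb =>
    obtain ⟨a, rfl⟩ := ha
    obtain ⟨b, rfl⟩ := hb
    exact ⟨a + b, map_add _ a b⟩

theorem restrict_polyRep {ρ : Representation ℂ Γ V} {g : Γ} {L : Submodule ℂ V}
    (hg : ∀ v ∈ L, ρ g v = v) (f : Poly V) : restrict L (polyRep ρ g f) = restrict L f := by
  have h : (restrict L).comp (polyHom ρ g) = restrict L := by
    apply SymmetricAlgebra.algHom_ext
    ext x : 1
    change restrict L (polyHom ρ g (SymmetricAlgebra.ι ℂ _ x)) =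
      restrict L (SymmetricAlgebra.ι ℂ _ x)
    rw [polyHom_ι, restrict_ι, restrict_ι]
    congr 1
    ext ⟨v, hv⟩
    change x (ρ g⁻¹ v) = x v
    congr 1
    conv_lhs => rw [← hg v hv]
    rw [← Module.End.mul_apply, ← map_mul, inv_mul_cancel, map_one, Module.End.one_apply]
  exact AlgHom.congr_fun h f

namespace QuotientSpace

variable {ρ : Representation ℂ Γ V} {N : Subgroup Γ} (E : QuotientSpace ρ N)

instance finiteDimensional_dualSpace : FiniteDimensional ℂ E.dualSpace.toSubmodule := by
  obtain ⟨r, f, d, -, hs⟩ := E.spanned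
  rw [← hs]
  exact FiniteDimensional.span_of_finite ℂ (Set.finite_range f)

theorem finrank_dualSpace : finrank ℂ E.dualSpace.toSubmodule = finrank ℂ V := by
  obtain ⟨r, f, d, hf, hs⟩ := E.spanned
  rw [← hs, finrank_span_eq_card hf.algebraicIndependent.linearIndependent, Fintype.card_fin,
    hf.dim]

/-- A reflection of `V` acts on `E` as a reflection or trivially. The polynomial functions on its
hyperplane `L` are integral over the algebra generated by the restrictions of `E^*` to `L`, so that
these restrictions span a space of dimension at least `dim L`; the range of `g - 1` on `E^*`
restricts to zero. -/
theorem finrank_range_sub_one_le [Finite N] [FiniteDimensional ℂ V] {g : Γ} {L : Submodule ℂ V}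
    (hL : finrank ℂ L + 1 = finrank ℂ V) (hg : ∀ v ∈ L, ρ g v = v) :
    finrank ℂ (LinearMap.range (E.dualSpace.toRepresentation g - 1)) ≤ 1 := by
  obtain ⟨r, f, d, hf, hs⟩ := id E.spanned
  let q : E.dualSpace.toSubmodule →ₗ[ℂ] Poly L :=
    (restrict L).toLinearMap ∘ₗ E.dualSpace.toSubmodule.subtype
  have hker : LinearMap.range (E.dualSpace.toRepresentation g - 1) ≤ LinearMap.ker q := by
    rintro _ ⟨x, rfl⟩
    change restrict L (polyRep ρ g x - x) = 0
    rw [map_sub, restrict_polyRep hg, sub_self]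
  let b := finBasis ℂ (LinearMap.range q)
  let y : Fin (finrank ℂ (LinearMap.range q)) → Poly L := fun j => b j
  have hmem : ∀ a ∈ invariantRing (ρ.comp N.subtype),
      restrict L a ∈ Algebra.adjoin ℂ (Set.range y) := by
    intro a ha
    rw [← hf.generate] at ha
    have h1 : (Algebra.adjoin ℂ (Set.range f)).map (restrict L) ≤
        Algebra.adjoin ℂ (Set.range y) := by
      rw [AlgHom.map_adjoin]
      refine Algebra.adjoin_le ?_
      rintro _ ⟨_, ⟨i, rfl⟩, rfl⟩
      apply Algebra.span_le_adjoin ℂ (Set.range y)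
      have h2 : Submodule.span ℂ (Set.range y) = LinearMap.range q := by
        have h3 : Set.range y = (LinearMap.range q).subtype '' Set.range b := by
          rw [← Set.range_comp]; rfl
        rw [h3, Submodule.span_image, b.span_eq, Submodule.map_top, Submodule.range_subtype]
      rw [h2]
      exact ⟨⟨f i, hs ▸ Submodule.subset_span ⟨i, rfl⟩⟩, rfl⟩
    exact h1 ⟨a, ha, rfl⟩
  have hint : Algebra.IsIntegral (Algebra.adjoin ℂ (Set.range y)) (Poly L) := by
    refine ⟨fun z => ?_⟩
    obtain ⟨z, rfl⟩ := restrict_surjective L z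
    let φ : invariantRing (ρ.comp N.subtype) →ₐ[ℂ] Algebra.adjoin ℂ (Set.range y) :=
      ((restrict L).comp (invariantRing (ρ.comp N.subtype)).val).codRestrict _
        fun a => hmem a a.2
    exact IsIntegral.map_of_comp_eq φ.toRingHom (restrict L).toRingHom rfl
      ((isIntegral_invariantRing (ρ.comp N.subtype)).isIntegral z)
  have h1 := finrank_le_card_of_isIntegral hint
  rw [Fintype.card_fin] at h1
  have h2 := LinearMap.finrank_range_add_finrank_ker q
  have h3 := Submodule.finrank_mono hker
  rw [E.finrank_dualSpace] at h2
  omega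

end QuotientSpace

end Reflections

/-! ### Polynomial functions on a dual space -/

section DualPoly

variable {Γ W W' W'' B : Type*} [Group Γ] [AddCommGroup W] [Module ℂ W]
  [AddCommGroup W'] [Module ℂ W'] [AddCommGroup W''] [Module ℂ W''] [CommRing B] [Algebra ℂ B]

variable (W) in
/-- The elements of `W` as linear forms on the dual space of `W`. -/
def evalι : W →ₗ[ℂ] Poly (Dual ℂ W) := SymmetricAlgebra.ι ℂ _ ∘ₗ Dual.eval ℂ W

theorem polyRep_evalι (τ : Representation ℂ Γ W) (g : Γ) (w : W) :
    polyRep τ.dual g (evalι W w) = evalι W (τ g w) := by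
  change polyRep τ.dual g (SymmetricAlgebra.ι ℂ _ (Dual.eval ℂ W w)) = _
  rw [polyRep_ι, dual_dual_eval]
  rfl

variable [FiniteDimensional ℂ W]

variable (W) in
theorem range_evalι : LinearMap.range (evalι W) = LinearMap.range (SymmetricAlgebra.ι ℂ _) := by
  rw [evalι, LinearMap.range_comp, ← evalEquiv_toLinearMap, LinearEquiv.range, Submodule.map_top]

/-- The extension of a linear map on `W` to the algebra of polynomial functions on the dual of
`W`. -/
def liftDual (φ : W →ₗ[ℂ] B) : Poly (Dual ℂ W) →ₐ[ℂ] B :=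
  SymmetricAlgebra.lift (φ ∘ₗ (evalEquiv ℂ W).symm.toLinearMap)

theorem liftDual_evalι (φ : W →ₗ[ℂ] B) (w : W) : liftDual φ (evalι W w) = φ w := by
  change liftDual φ (SymmetricAlgebra.ι ℂ _ (evalEquiv ℂ W w)) = _
  rw [liftDual, SymmetricAlgebra.lift_ι_apply]
  exact congrArg φ ((evalEquiv ℂ W).symm_apply_apply w)

theorem dualPoly_algHom_ext {F G : Poly (Dual ℂ W) →ₐ[ℂ] B}
    (h : ∀ w, F (evalι W w) = G (evalι W w)) : F = G := by
  apply SymmetricAlgebra.algHom_ext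
  ext x : 1
  obtain ⟨w, rfl⟩ := (evalEquiv ℂ W).surjective x
  exact h w

theorem liftDual_mem_pow {φ : W →ₗ[ℂ] B} {S : Submodule ℂ B} (hφ : ∀ w, φ w ∈ S) {n : ℕ}
    {f : Poly (Dual ℂ W)} (hf : f ∈ homog (Dual ℂ W) n) : liftDual φ f ∈ S ^ n := by
  have h1 : (LinearMap.range (evalι W)).map (liftDual φ).toLinearMap ≤ S := by
    rintro _ ⟨_, ⟨w, rfl⟩, rfl⟩
    change liftDual φ (evalι W w) ∈ S
    rw [liftDual_evalι]
    exact hφ w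
  have h2 : (homog (Dual ℂ W) n).map (liftDual φ).toLinearMap ≤ S ^ n := by
    rw [homog, ← range_evalι, Submodule.map_pow]
    exact pow_le_pow_left' h1 n
  exact h2 ⟨f, hf, rfl⟩

theorem liftDual_comp {B' : Type*} [CommRing B'] [Algebra ℂ B'] (φ : W →ₗ[ℂ] B) (F : B →ₐ[ℂ] B')
    (f : Poly (Dual ℂ W)) : F (liftDual φ f) = liftDual (F.toLinearMap ∘ₗ φ) f := by
  have h : F.comp (liftDual φ) = liftDual (F.toLinearMap ∘ₗ φ) :=
    dualPoly_algHom_ext fun w => by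
      rw [AlgHom.comp_apply, liftDual_evalι, liftDual_evalι]; rfl
  exact AlgHom.congr_fun h f

theorem liftDual_polyRep {τ : Representation ℂ Γ W} {φ : W →ₗ[ℂ] B} {g : Γ} {ψ : B →ₐ[ℂ] B}
    (h : ∀ w, φ (τ g w) = ψ (φ w)) (f : Poly (Dual ℂ W)) :
    liftDual φ (polyRep τ.dual g f) = ψ (liftDual φ f) := by
  have h1 : (liftDual φ).comp (polyHom τ.dual g) = ψ.comp (liftDual φ) :=
    dualPoly_algHom_ext fun w => by
      rw [AlgHom.comp_apply, AlgHom.comp_apply, ← polyRep_apply, polyRep_evalι, liftDual_evalι,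
        liftDual_evalι, h]
  exact AlgHom.congr_fun h1 f

/-- The algebra homomorphism between polynomial functions on dual spaces induced by a linear
map. -/
def mapDual (q : W →ₗ[ℂ] W') : Poly (Dual ℂ W) →ₐ[ℂ] Poly (Dual ℂ W') := liftDual (evalι W' ∘ₗ q)

theorem mapDual_evalι (q : W →ₗ[ℂ] W') (w : W) : mapDual q (evalι W w) = evalι W' (q w) :=
  liftDual_evalι _ w

theorem liftDual_mapDual [FiniteDimensional ℂ W'] (q : W →ₗ[ℂ] W') (φ : W' →ₗ[ℂ] B)
    (f : Poly (Dual ℂ W)) :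
    liftDual φ (mapDual q f) = liftDual (φ ∘ₗ q) f := by
  rw [mapDual, liftDual_comp]
  congr 2
  ext w
  exact liftDual_evalι φ (q w)

theorem mapDual_mapDual [FiniteDimensional ℂ W'] (q : W →ₗ[ℂ] W')
    (q' : W' →ₗ[ℂ] W'') (f : Poly (Dual ℂ W)) :
    mapDual q' (mapDual q f) = mapDual (q' ∘ₗ q) f :=
  liftDual_mapDual q _ f

theorem mapDual_id (f : Poly (Dual ℂ W)) : mapDual LinearMap.id f = f := by
  have h : mapDual (LinearMap.id : W →ₗ[ℂ] W) = AlgHom.id ℂ _ :=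
    dualPoly_algHom_ext fun w => mapDual_evalι _ w
  exact AlgHom.congr_fun h f

theorem mapDual_mem_homog (q : W →ₗ[ℂ] W') {n : ℕ} {f : Poly (Dual ℂ W)}
    (hf : f ∈ homog (Dual ℂ W) n) : mapDual q f ∈ homog (Dual ℂ W') n :=
  liftDual_mem_pow (S := LinearMap.range (SymmetricAlgebra.ι ℂ _))
    (fun w => ⟨Dual.eval ℂ W' (q w), rfl⟩) hf

theorem mapDual_zero {n : ℕ} (hn : 0 < n) {f : Poly (Dual ℂ W)} (hf : f ∈ homog (Dual ℂ W) n) :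
    mapDual (0 : W →ₗ[ℂ] W') f = 0 := by
  have h := liftDual_mem_pow (φ := evalι W' ∘ₗ (0 : W →ₗ[ℂ] W')) (S := ⊥) (fun w => by simp) hf
  rw [← Submodule.zero_eq_bot, zero_pow hn.ne'] at h
  exact h

variable {τ : Representation ℂ Γ W} {τ' : Representation ℂ Γ W'} {q : W →ₗ[ℂ] W'}

theorem mapDual_polyRep {g : Γ} (hq : ∀ w, q (τ g w) = τ' g (q w)) (f : Poly (Dual ℂ W)) :
    mapDual q (polyRep τ.dual g f) = polyRep τ'.dual g (mapDual q f) :=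
  liftDual_polyRep (ψ := polyHom τ'.dual g) (fun w => by
    rw [LinearMap.comp_apply, LinearMap.comp_apply, ← polyRep_apply, polyRep_evalι, hq]) f

theorem mapDual_mem_posInv (hq : ∀ g w, q (τ g w) = τ' g (q w)) {f : Poly (Dual ℂ W)}
    (hf : f ∈ posInv τ.dual) : mapDual q f ∈ posInv τ'.dual := by
  refine ⟨fun g => ?_, ?_⟩
  · rw [← mapDual_polyRep (hq g), hf.1 g]
  · change part _ 0 ((mapDual q).toLinearMap f) = 0
    rw [part_comm _ fun n f hf => mapDual_mem_homog q hf, LinearMap.mem_ker.1 hf.2, map_zero]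

theorem mapDual_mem_decomposables (hq : ∀ g w, q (τ g w) = τ' g (q w)) {f : Poly (Dual ℂ W)}
    (hf : f ∈ decomposables τ.dual) : mapDual q f ∈ decomposables τ'.dual := by
  unfold decomposables at hf
  induction hf using Submodule.mul_induction_on' with
  | mem_mul_mem a ha b hb =>
    rw [map_mul]
    exact Submodule.mul_mem_mul (mapDual_mem_posInv hq ha) (mapDual_mem_posInv hq hb)
  | add x _ y _ hx hy => rw [map_add]; exact add_mem hx hy

theorem generatedByReflections_dual
    (h : Subgroup.closure {g | finrank ℂ (LinearMap.range (τ g - 1)) ≤ 1} = ⊤) :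
    GeneratedByReflections τ.dual :=
  eq_top_iff.2 <| h.ge.trans <| Subgroup.closure_mono fun g hg =>
    (finrank_range_dual_dual_sub_one τ g).trans hg

/-- Let a reflection group act on `W` preserving a direct sum decomposition. Then it has fundamental
invariants each of which involves the elements of a single summand: those of the summands, on each
of which the group acts as a reflection group. They are independent modulo the decomposable
invariants, and there are enough of them. -/
theorem exists_pure_invariants [Finite Γ]
    (hτ : Subgroup.closure {g | finrank ℂ (LinearMap.range (τ g - 1)) ≤ 1} = ⊤)
    {K : Type*} [DecidableEq K] {A : K → Type*} [∀ k, AddCommGroup (A k)] [∀ k, Module ℂ (A k)]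
    [∀ k, FiniteDimensional ℂ (A k)] (σ : ∀ k, Representation ℂ Γ (A k)) (j : ∀ k, A k →ₗ[ℂ] W)
    (q : ∀ k, W →ₗ[ℂ] A k) (hj : ∀ k g x, j k (σ k g x) = τ g (j k x))
    (hq : ∀ k g w, q k (τ g w) = σ k g (q k w)) (hqj : ∀ k, q k ∘ₗ j k = LinearMap.id)
    (hqj₀ : ∀ k l, l ≠ k → q k ∘ₗ j l = 0) {r : ℕ} (hr : finrank ℂ W = r) (d : Fin r → K)
    (hd : ∀ k, Fintype.card {i // d i = k} = finrank ℂ (A k)) :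
    ∃ (F : Fin r → Poly (Dual ℂ W)) (n : Fin r → ℕ), IsFundamentalInvariants τ.dual F n ∧
      ∀ i, F i ∈ ((LinearMap.range (j (d i))).map (evalι W)) ^ n i := by
  have hσ : ∀ k, GeneratedByReflections (σ k).dual := fun k => by
    apply generatedByReflections_dual
    refine eq_top_iff.2 (hτ.ge.trans (Subgroup.closure_mono fun g hg => ?_))
    refine le_trans ?_ (show _ ≤ 1 from hg)
    have hinj : Function.Injective (j k) :=
      Function.LeftInverse.injective (g := q k) (LinearMap.congr_fun (hqj k))
    have h1 : (LinearMap.range (σ k g - 1)).map (j k) ≤ LinearMap.range (τ g - 1) := by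
      rintro _ ⟨_, ⟨x, rfl⟩, rfl⟩
      refine ⟨j k x, ?_⟩
      change τ g (j k x) - j k x = j k (σ k g x - x)
      rw [map_sub, hj]
    rw [(Submodule.equivMapOfInjective (j k) hinj _).finrank_eq]
    exact Submodule.finrank_mono h1
  choose F' n' hpos' hhom' hind' using fun k =>
    exists_linearIndependent_decomposables (hσ k) (ι := {i // d i = k})
      (by rw [Subspace.dual_finrank_eq]; exact hd k)
  have hn' : ∀ k i, 0 < n' k i := fun k =>
    pos_of_linearIndependent (hpos' k) (hhom' k) (hind' k)
  let F : Fin r → Poly (Dual ℂ W) := fun i => mapDual (j (d i)) (F' (d i) ⟨i, rfl⟩)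
  have hF : ∀ i, F i ∈ posInv τ.dual := fun i => mapDual_mem_posInv (hj _) (hpos' _ _)
  have hn : ∀ i, F i ∈ homog (Dual ℂ W) (n' (d i) ⟨i, rfl⟩) := fun i =>
    mapDual_mem_homog _ (hhom' _ _)
  have hF_eq : ∀ k (i : {i // d i = k}), mapDual (q k) (F i) = F' k i := by
    rintro _ ⟨i, rfl⟩
    rw [mapDual_mapDual, hqj, mapDual_id]
  have hF_ne : ∀ k i, d i ≠ k → mapDual (q k) (F i) = 0 := fun k i hi => by
    rw [mapDual_mapDual, hqj₀ k _ hi]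
    exact mapDual_zero (hn' _ _) (hhom' _ _)
  have hind : LinearIndependent ℂ fun i => (decomposables τ.dual).mkQ (F i) := by
    rw [Fintype.linearIndependent_iff]
    intro c hc i
    simp only [← map_smul, ← map_sum] at hc
    rw [Submodule.mkQ_apply, Submodule.Quotient.mk_eq_zero] at hc
    -- Project the relation to the summand containing the index `i`.
    have h1 := mapDual_mem_decomposables (hq (d i)) hc
    have h2 : mapDual (q (d i)) (∑ i, c i • F i) =
        ∑ j : {j // d j = d i}, c j • F' (d i) j := by
      simp only [map_sum, map_smul, ← hF_eq]
      rw [← Finset.sum_subtype (Finset.univ.filter fun j => d j = d i) (by simp)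
        fun j => c j • mapDual (q (d i)) (F j), Finset.sum_filter]
      refine Finset.sum_congr rfl fun j _ => ?_
      split_ifs with h
      · rfl
      · rw [hF_ne _ _ h, smul_zero]
    rw [h2] at h1
    refine Fintype.linearIndependent_iff.1 (hind' (d i)) (fun j => c j) ?_ ⟨i, rfl⟩
    simp only [← map_smul, ← map_sum]
    rw [Submodule.mkQ_apply, Submodule.Quotient.mk_eq_zero]
    exact h1
  refine ⟨F, fun i => n' (d i) ⟨i, rfl⟩, isFundamentalInvariants_of_linearIndependent
    (generatedByReflections_dual hτ) (by rw [Subspace.dual_finrank_eq, hr]) hF hn hind,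
    fun i => ?_⟩
  exact liftDual_mem_pow (S := (LinearMap.range (j (d i))).map (evalι W))
    (fun w => ⟨j (d i) w, ⟨w, rfl⟩, rfl⟩) (hhom' _ _)

end DualPoly

/-! ### The action of the quotient group on `E` -/

namespace QuotientSpace

variable {Γ V : Type*} [Group Γ] [AddCommGroup V] [Module ℂ V]
  {ρ : Representation ℂ Γ V} {N : Subgroup Γ} (E : QuotientSpace ρ N)

/-- The identification of polynomial functions on `E = V/N` with `N`-invariant polynomial functions
on `V`. -/
def toPoly : Poly E.Space →ₐ[ℂ] Poly V := liftDual E.dualSpace.toSubmodule.subtype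

theorem toPoly_evalι (w : E.dualSpace.toSubmodule) : E.toPoly (evalι _ w) = w :=
  liftDual_evalι _ w

/-- In the coordinates on `E` given by fundamental invariants of `N`, the identification is the
substitution of these invariants for the variables. -/
theorem exists_toPoly_eq {r : ℕ} {f : Fin r → Poly V} {d : Fin r → ℕ}
    (hf : IsFundamentalInvariants (ρ.comp N.subtype) f d)
    (hs : Submodule.span ℂ (Set.range f) = E.dualSpace.toSubmodule) :
    ∃ e : Poly E.Space ≃ₐ[ℂ] MvPolynomial (Fin r) ℂ,
      E.toPoly = (MvPolynomial.aeval f).comp e.toAlgHom := by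
  let b₀ : Basis (Fin r) ℂ E.dualSpace.toSubmodule :=
    (Basis.span hf.algebraicIndependent.linearIndependent).map (LinearEquiv.ofEq _ _ hs)
  have hb₀ : ∀ i, (b₀ i : Poly V) = f i := fun i => by
    simp [b₀, Basis.span_apply]
  let e := SymmetricAlgebra.equivMvPolynomial (b₀.map (evalEquiv ℂ _))
  refine ⟨e, ?_⟩
  have h : E.toPoly.comp e.symm.toAlgHom = MvPolynomial.aeval f := by
    refine MvPolynomial.algHom_ext fun i => ?_
    change E.toPoly (e.symm (MvPolynomial.X i)) = _
    rw [SymmetricAlgebra.equivMvPolynomial_symm_X, MvPolynomial.aeval_X, ← hb₀]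
    exact E.toPoly_evalι (b₀ i)
  rw [← h]
  ext x
  simp

theorem toPoly_injective : Function.Injective E.toPoly := by
  obtain ⟨r, f, d, hf, hs⟩ := id E.spanned
  obtain ⟨e, he⟩ := E.exists_toPoly_eq hf hs
  rw [he]
  change Function.Injective (MvPolynomial.aeval f ∘ e)
  exact Function.Injective.comp (algebraicIndependent_iff_injective_aeval.1
    hf.algebraicIndependent) e.injective

theorem range_toPoly : E.toPoly.range = invariantRing (ρ.comp N.subtype) := by
  obtain ⟨r, f, d, hf, hs⟩ := id E.spanned
  obtain ⟨e, he⟩ := E.exists_toPoly_eq hf hs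
  rw [← hf.generate, Algebra.adjoin_range_eq_range_aeval, he]
  ext x
  constructor
  · rintro ⟨y, rfl⟩
    exact ⟨e y, rfl⟩
  · rintro ⟨y, rfl⟩
    exact ⟨e.symm y, by simp⟩

theorem part_mem_dualSpace (k : ℕ) {x : Poly V} (hx : x ∈ E.dualSpace.toSubmodule) :
    part V k x ∈ E.dualSpace.toSubmodule := by
  obtain ⟨r, f, d, hf, hs⟩ := id E.spanned
  rw [← hs] at hx ⊢
  induction hx using Submodule.span_induction with
  | mem x hx =>
    obtain ⟨i, rfl⟩ := hx
    by_cases h : d i = k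
    · rw [part_of_mem (h ▸ hf.homogeneous i)]
      exact Submodule.subset_span ⟨i, rfl⟩
    · rw [part_of_mem_ne (hf.homogeneous i) h]
      exact zero_mem _
  | zero => rw [map_zero]; exact zero_mem _
  | add x y _ _ hx hy => rw [map_add]; exact add_mem hx hy
  | smul c x _ hx => rw [map_smul]; exact Submodule.smul_mem _ _ hx

/-- The homogeneous component of `E^*` of degree `k`. -/
def dualPiece (k : ℕ) : Subrepresentation (polyRep ρ) where
  toSubmodule := E.dualSpace.toSubmodule ⊓ homog V k
  apply_mem_toSubmodule g _ hx :=
    ⟨E.dualSpace.apply_mem_toSubmodule g hx.1, polyHom_homog ρ g k hx.2⟩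

instance finiteDimensional_dualPiece (k : ℕ) :
    FiniteDimensional ℂ (E.dualPiece k).toSubmodule :=
  Submodule.finiteDimensional_of_le (S₂ := E.dualSpace.toSubmodule) inf_le_left

theorem dualPiece_isTrivial (k : ℕ) :
    Representation.IsTrivial (((E.dualPiece k).toRepresentation).comp N.subtype) where
  out n := by
    ext x
    exact E.dualSpace_le x.1 x.2.1 n

/-- The projection of `E^*` onto its homogeneous component of degree `k`. -/
def toDualPiece (k : ℕ) : E.dualSpace.toSubmodule →ₗ[ℂ] (E.dualPiece k).toSubmodule :=
  LinearMap.codRestrict _ (part V k ∘ₗ E.dualSpace.toSubmodule.subtype)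
    fun x => ⟨E.part_mem_dualSpace k x.2, part_mem k (x : Poly V)⟩

/-- The inclusion of the homogeneous component of degree `k` into `E^*`. -/
def ofDualPiece (k : ℕ) : (E.dualPiece k).toSubmodule →ₗ[ℂ] E.dualSpace.toSubmodule :=
  Submodule.inclusion inf_le_left

theorem finrank_dualPiece {r : ℕ} {f : Fin r → Poly V} {d : Fin r → ℕ}
    (hf : IsFundamentalInvariants (ρ.comp N.subtype) f d)
    (hs : Submodule.span ℂ (Set.range f) = E.dualSpace.toSubmodule) (k : ℕ) :
    Fintype.card {i // d i = k} = finrank ℂ (E.dualPiece k).toSubmodule := by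
  have hlin : LinearIndependent ℂ fun i : {i // d i = k} => f i :=
    hf.algebraicIndependent.linearIndependent.comp _ Subtype.val_injective
  have h1 : Submodule.span ℂ (Set.range fun i : {i // d i = k} => f i) =
      (E.dualPiece k).toSubmodule := by
    apply le_antisymm
    · refine Submodule.span_le.2 ?_
      rintro _ ⟨⟨i, hi⟩, rfl⟩
      exact ⟨hs ▸ Submodule.subset_span ⟨i, rfl⟩, hi ▸ hf.homogeneous i⟩
    · rintro x ⟨hx, hxk⟩
      rw [← hs] at hx
      obtain ⟨c, rfl⟩ := (Submodule.mem_span_range_iff_exists_fun ℂ).1 hx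
      rw [← part_of_mem hxk, map_sum]
      refine Submodule.sum_mem _ fun i _ => ?_
      rw [map_smul]
      by_cases h : d i = k
      · rw [part_of_mem (h ▸ hf.homogeneous i)]
        exact Submodule.smul_mem _ _ (Submodule.subset_span ⟨⟨i, h⟩, rfl⟩)
      · rw [part_of_mem_ne (hf.homogeneous i) h, smul_zero]
        exact zero_mem _
  rw [← h1, finrank_span_eq_card hlin]

variable [N.Normal]

/-- The action of the quotient group on `E^*`. -/
def dualRep : Representation ℂ (Γ ⧸ N) E.dualSpace.toSubmodule :=
  have := E.isTrivial
  Representation.ofQuotient E.dualSpace.toRepresentation N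

theorem toPoly_polyRep (g : Γ) (F : Poly E.Space) :
    E.toPoly (polyRep E.quotientRep (g : Γ ⧸ N) F) = polyRep ρ g (E.toPoly F) := by
  exact liftDual_polyRep (τ := E.dualRep) (ψ := polyHom ρ g) (fun _ => rfl) F

theorem map_toPoly_invariantRing :
    (invariantRing E.quotientRep).map E.toPoly = invariantRing ρ := by
  ext x
  constructor
  · rintro ⟨F, hF, rfl⟩ g
    change polyRep ρ g (E.toPoly F) = E.toPoly F
    rw [← toPoly_polyRep, hF]
  · intro hx
    have h1 : x ∈ E.toPoly.range := by
      rw [range_toPoly]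
      exact fun n => hx n
    obtain ⟨F, rfl⟩ := h1
    refine ⟨F, fun h => ?_, rfl⟩
    obtain ⟨g, rfl⟩ := QuotientGroup.mk_surjective h
    apply E.toPoly_injective
    rw [toPoly_polyRep]
    exact hx g

theorem closure_dualRep_eq_top [Finite N] [FiniteDimensional ℂ V] {X : Set Γ}
    (hX : Subgroup.closure X = ⊤)
    (h : ∀ g ∈ X, ∃ L : Submodule ℂ V, finrank ℂ L + 1 = finrank ℂ V ∧ ∀ v ∈ L, ρ g v = v) :
    Subgroup.closure {h | finrank ℂ (LinearMap.range (E.dualRep h - 1)) ≤ 1} = ⊤ := by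
  have h1 : (Subgroup.closure X).map (QuotientGroup.mk' N) = ⊤ := by
    rw [hX, ← MonoidHom.range_eq_map, MonoidHom.range_eq_top]
    exact QuotientGroup.mk'_surjective N
  rw [MonoidHom.map_closure] at h1
  refine eq_top_iff.2 (h1.ge.trans (Subgroup.closure_mono ?_))
  rintro _ ⟨g, hg, rfl⟩
  obtain ⟨L, hL, hgL⟩ := h g hg
  exact E.finrank_range_sub_one_le hL hgL

/-- The action of the quotient group on the homogeneous component of `E^*` of degree `k`. -/
def dualPieceRep (k : ℕ) : Representation ℂ (Γ ⧸ N) (E.dualPiece k).toSubmodule :=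
  have := E.dualPiece_isTrivial k
  Representation.ofQuotient (E.dualPiece k).toRepresentation N

/-- The quotient group has fundamental invariants each of which involves only the fundamental
invariants of `N` of a single degree. -/
theorem exists_homogeneous_invariants [Finite Γ] {r : ℕ} {f : Fin r → Poly V} {d : Fin r → ℕ}
    (hf : IsFundamentalInvariants (ρ.comp N.subtype) f d)
    (hs : Submodule.span ℂ (Set.range f) = E.dualSpace.toSubmodule)
    (hH : Subgroup.closure {h | finrank ℂ (LinearMap.range (E.dualRep h - 1)) ≤ 1} = ⊤) :
    ∃ (F : Fin r → Poly E.Space) (n : Fin r → ℕ), IsFundamentalInvariants E.quotientRep F n ∧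
      ∀ i, E.toPoly (F i) ∈ (E.dualSpace.toSubmodule ⊓ homog V (d i)) ^ n i := by
  obtain ⟨F, n, hF, hFn⟩ := exists_pure_invariants hH E.dualPieceRep E.ofDualPiece E.toDualPiece
    (fun k h x => by
      obtain ⟨g, rfl⟩ := QuotientGroup.mk_surjective h
      rfl)
    (fun k h x => by
      obtain ⟨g, rfl⟩ := QuotientGroup.mk_surjective h
      exact Subtype.ext (part_polyRep ρ g k x))
    (fun k => LinearMap.ext fun x => Subtype.ext (part_of_mem x.2.2))
    (fun k l hkl => LinearMap.ext fun x => Subtype.ext (part_of_mem_ne x.2.2 hkl))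
    (E.finrank_dualSpace.trans hf.dim) d (E.finrank_dualPiece hf hs)
  refine ⟨F, n, hF, fun i => ?_⟩
  have h1 : ((LinearMap.range (E.ofDualPiece (d i))).map (evalι _)).map E.toPoly.toLinearMap ≤
      E.dualSpace.toSubmodule ⊓ homog V (d i) := by
    rintro _ ⟨_, ⟨_, ⟨x, rfl⟩, rfl⟩, rfl⟩
    change E.toPoly (evalι _ (E.ofDualPiece (d i) x)) ∈ _
    rw [toPoly_evalι]
    exact x.2
  have h2 := pow_le_pow_left' h1 (n i)
  rw [← Submodule.map_pow] at h2
  exact h2 ⟨F i, hFn i, rfl⟩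

/-- Fundamental invariants of the quotient group on `E` are, as polynomial functions on `V`,
fundamental invariants of the whole group. -/
theorem isFundamentalInvariants_toPoly {r : ℕ} {F : Fin r → Poly E.Space} {n m : Fin r → ℕ}
    (hF : IsFundamentalInvariants E.quotientRep F n)
    (hm : ∀ i, E.toPoly (F i) ∈ homog V (m i)) :
    IsFundamentalInvariants ρ (fun i => E.toPoly (F i)) m where
  dim := by rw [← hF.dim, Subspace.dual_finrank_eq, E.finrank_dualSpace]
  homogeneous := hm
  algebraicIndependent := hF.algebraicIndependent.map' E.toPoly_injective
  generate := by
    rw [← map_toPoly_invariantRing E, ← hF.generate, AlgHom.map_adjoin, ← Set.range_comp]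
    rfl

/-- The degrees and fake degrees of `N`, `G` and `G/N`, for a finite group `G` whose subgroup `N`
acts as a reflection group on `V` and such that `G/N` acts as a reflection group on `E`. -/
theorem exists_degrees [Finite Γ] [FiniteDimensional ℂ V] (hG : GeneratedByReflections ρ)
    (hN : GeneratedByReflections (ρ.comp N.subtype))
    (hH : Subgroup.closure {h | finrank ℂ (LinearMap.range (E.dualRep h - 1)) ≤ 1} = ⊤) {r : ℕ}
    (hr : finrank ℂ V = r) :
    ∃ dN dG dH eNV eGV eGE eHE : Fin r → ℕ,
      HasDegrees (ρ.comp N.subtype) dN ∧ HasDegrees ρ dG ∧ HasDegrees E.quotientRep dH ∧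
      HasFakeDegrees (ρ.comp N.subtype) (ρ.comp N.subtype) eNV ∧ HasFakeDegrees ρ ρ eGV ∧
      HasFakeDegrees ρ E.rep eGE ∧ HasFakeDegrees E.quotientRep E.quotientRep eHE ∧
      (∀ i, eNV i + 1 = dN i ∧ eGV i + 1 = dG i ∧ eHE i + 1 = dH i) ∧
      (∀ i, eNV i + eGE i = eGV i) ∧ (∀ i, dN i * dH i = dG i) ∧
      (∀ i, dN i * eHE i = eGE i) := by
  obtain ⟨r', f, d, hf, hs⟩ := id E.spanned
  obtain rfl : r = r' := hr.symm.trans hf.dim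
  obtain ⟨F, n, hF, hpure⟩ := E.exists_homogeneous_invariants hf hs hH
  have hpow : ∀ k m, (E.dualSpace.toSubmodule ⊓ homog V k) ^ m ≤ homog V (k * m) := fun k m => by
    rw [homog, homog, pow_mul]
    exact pow_le_pow_left' inf_le_right m
  have hFG := E.isFundamentalInvariants_toPoly hF fun i => hpow _ _ (hpure i)
  have hdpos : ∀ i, 1 ≤ d i := hf.pos
  have hnpos : ∀ i, 1 ≤ n i := hF.pos
  have hGpos : ∀ i, 1 ≤ d i * n i := hFG.pos
  refine ⟨d, fun i => d i * n i, n, fun i => d i - 1, fun i => d i * n i - 1,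
    fun i => d i * (n i - 1), fun i => n i - 1, ⟨f, hf⟩, ⟨_, hFG⟩, ⟨F, hF⟩,
    hf.hasFakeDegrees hN fun i => Nat.sub_add_cancel (hdpos i),
    hFG.hasFakeDegrees hG fun i => Nat.sub_add_cancel (hGpos i), ?_,
    hF.hasFakeDegrees (generatedByReflections_dual hH) fun i => Nat.sub_add_cancel (hnpos i),
    fun i => ⟨Nat.sub_add_cancel (hdpos i), Nat.sub_add_cancel (hGpos i),
      Nat.sub_add_cancel (hnpos i)⟩, fun i => ?_, fun _ => rfl, fun _ => rfl⟩
  · -- The invariants of `G` are contracted with the inclusion of `E^*` into `S(V^*)`.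
    let t : Dual ℂ E.Space →ₗ[ℂ] Poly V :=
      E.dualSpace.toSubmodule.subtype ∘ₗ (evalEquiv ℂ E.dualSpace.toSubmodule).symm.toLinearMap
    have ht_eval : ∀ w, t (evalEquiv ℂ E.dualSpace.toSubmodule w) = w := fun w =>
      congrArg Subtype.val ((evalEquiv ℂ E.dualSpace.toSubmodule).symm_apply_apply w)
    refine hasFakeDegrees_of_indecomposable (σ := E.rep) hG (t := t) (fun g x => ?_) (fun x => ?_)
      (by rw [Subspace.dual_finrank_eq, E.finrank_dualSpace, hr]) hFG.mem_posInv (fun i => ?_)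
      hFG.linearIndependent
    · obtain ⟨w, rfl⟩ := (evalEquiv ℂ E.dualSpace.toSubmodule).surjective x
      have h1 : E.rep.dual g (evalEquiv ℂ E.dualSpace.toSubmodule w) =
          evalEquiv ℂ E.dualSpace.toSubmodule (E.dualSpace.toRepresentation g w) :=
        dual_dual_eval g w
      rw [h1, ht_eval, ht_eval]
      rfl
    · obtain ⟨w, rfl⟩ := (evalEquiv ℂ E.dualSpace.toSubmodule).surjective x
      rw [ht_eval]
      have h1 : E.dualSpace.toSubmodule ≤ LinearMap.ker (part V 0) := by
        rw [← hs, Submodule.span_le]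
        rintro _ ⟨i, rfl⟩
        exact (hf.mem_posInv i).2
      exact h1 w.2
    · have h1 : E.dualSpace.toSubmodule ⊓ homog V (d i) ≤ LinearMap.range t :=
        fun w hw => ⟨evalEquiv ℂ _ ⟨w, hw.1⟩, ht_eval _⟩
      have h2 := hpure i
      rw [← Nat.sub_add_cancel (hnpos i), pow_succ'] at h2
      exact SetLike.le_def.1 (mul_le_mul' h1 (hpow _ _)) h2
  · have h1 := hdpos i
    obtain ⟨m, hm⟩ := Nat.exists_eq_add_of_le (hnpos i)
    dsimp only
    rw [hm, Nat.add_sub_cancel_left, mul_add, mul_one]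
    omega

end QuotientSpace

/-! ### Reflection groups in `GL(V)` -/

section ReflectionGroups

variable {V : Type*} [AddCommGroup V] [Module ℂ V]
  {G : Subgroup (LinearMap.GeneralLinearGroup ℂ V)}

theorem IsReflectionGroup.closure_eq_top (hG : IsReflectionGroup G) :
    Subgroup.closure {g : G | IsReflection (g : LinearMap.GeneralLinearGroup ℂ V)} = ⊤ :=
  closure_eq_top_of_injective (f := G.subtype) G.subtype_injective
    (hG.generated.trans G.range_subtype.symm) fun g hg => ⟨⟨g, hg.1⟩, hg.2, rfl⟩

variable [FiniteDimensional ℂ V]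

theorem IsReflectionGroup.generatedByReflections (hG : IsReflectionGroup G) :
    GeneratedByReflections (stdRep G) := by
  refine eq_top_iff.2 (hG.closure_eq_top.ge.trans (Subgroup.closure_mono ?_))
  rintro g ⟨L, hL, hgL⟩
  exact finrank_range_dual_sub_one_le hL hgL

theorem IsReflectionGroup.generatedByReflections_comp_subtype {N : Subgroup G}
    (hN : IsReflectionGroup (N.map G.subtype)) :
    GeneratedByReflections ((stdRep G).comp N.subtype) := by
  refine closure_eq_top_of_injective (f := G.subtype.comp N.subtype)
    (G.subtype_injective.comp N.subtype_injective)
    (hN.generated.trans (by rw [MonoidHom.range_comp, Subgroup.range_subtype])) ?_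
  rintro _ ⟨⟨g, hg, rfl⟩, L, hL, hgL⟩
  exact ⟨⟨g, hg⟩, finrank_range_dual_sub_one_le hL hgL, rfl⟩

end ReflectionGroups

end ReflQuot

end

theorem mainTheorem2 {V : Type*} [AddCommGroup V] [Module ℂ V] [FiniteDimensional ℂ V]
    (r : ℕ) (hr : Module.finrank ℂ V = r)
    (G : Subgroup (LinearMap.GeneralLinearGroup ℂ V)) (hG : ReflQuot.IsReflectionGroup G)
    (N : Subgroup G) [N.Normal] (hN : ReflQuot.IsReflectionGroup (N.map G.subtype)) :
    Nonempty (ReflQuot.QuotientSpace (ReflQuot.stdRep G) N) ∧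
    ∀ E : ReflQuot.QuotientSpace (ReflQuot.stdRep G) N,
      ∃ dN dG dH eNV eGV eGE eHE : Fin r → ℕ,
        -- degrees of `N` and `G` on `V`, and of `H = G/N` on `E`
        ReflQuot.HasDegrees ((ReflQuot.stdRep G).comp N.subtype) dN ∧
        ReflQuot.HasDegrees (ReflQuot.stdRep G) dG ∧
        ReflQuot.HasDegrees E.quotientRep dH ∧
        -- fake degrees of `V` for `N` and `G`, and of `E` for `G` and `H`
        ReflQuot.HasFakeDegrees ((ReflQuot.stdRep G).comp N.subtype)
          ((ReflQuot.stdRep G).comp N.subtype) eNV ∧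
        ReflQuot.HasFakeDegrees (ReflQuot.stdRep G) (ReflQuot.stdRep G) eGV ∧
        ReflQuot.HasFakeDegrees (ReflQuot.stdRep G) E.rep eGE ∧
        ReflQuot.HasFakeDegrees E.quotientRep E.quotientRep eHE ∧
        -- degrees and fake degrees are indexed compatibly
        (∀ i, eNV i + 1 = dN i ∧ eGV i + 1 = dG i ∧ eHE i + 1 = dH i) ∧
        -- the three identities
        (∀ i, eNV i + eGE i = eGV i) ∧
        (∀ i, dN i * dH i = dG i) ∧
        (∀ i, dN i * eHE i = eGE i) := by
  have := hG.finite
  refine ⟨ReflQuot.nonempty_quotientSpace hN.generatedByReflections_comp_subtype, fun E => ?_⟩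
  exact E.exists_degrees hG.generatedByReflections hN.generatedByReflections_comp_subtype
    (E.closure_dualRep_eq_top hG.closure_eq_top fun _ hg => hg) hr
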